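/- Let $h\ge 1$, $k\ge 0$ be integers and $\Lambda=(-1,1)^h$. Let $\mu$ be a measure on $\Lambda$ of Jacobi type: there are exponents $\alpha_j,\beta_j>-1$ and constants $0<a\le b<\infty$ such that $a\,J\le\mu\le b\,J$, where $dJ=\prod_{j=1}^h(1-y_j)^{\alpha_j}(1+y_j)^{\beta_j}\,dy$ (this includes the Legendre and Chebyshev measures). For $f:\Lambda\to\mathbb R^m$ (with the Euclidean norm on $\mathbb R^m$) and a multi-index $\mathbf i$ let $\partial^{(\mathbf i)}f$ be the weak derivative on $\Lambda$. Let $H^k_\mu(\Lambda)$ be the space of $f\in L^2_\mu(\Lambda)$ whose weak derivatives $\partial^{(\mathbf i)}f$ with $|\mathbf i|\le k$ exist and lie in $L^2_\mu(\Lambda)$, with norm $\|f\|_{H^k_\mu(\Lambda)}=\sum_{|\mathbf i|\le k}\|\partial^{(\mathbf i)}f\|_{L^2_\mu(\Lambda)}$. For integers $L\ge 0$, $P\ge 1$ and matrices $W_1,\dots,W_L\in\mathbf M(P-1,h)$ let $\mathcal T(y)=\bigotimes_{l=1}^L\bigl(1\oplus W_l\,y\bigr)\in(\mathbb R^P)^{\otimes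 L}\cong\mathbb R^{P^L}$ for $y\in\mathbb R^h$, and put $N=\min\bigl(L,\lfloor L(P-1)/h\rfloor\bigr)$. Then there is a finite constant $C$, depending only on $h$, $k$ and $\mu$, such that for all $L\ge0$, $P\ge1$ with $$(h-1)\,h\,P^L\ \ge\ h^{1+N}-1$$ the matrices $W_1,\dots,W_L$ can be chosen so that for every $m$ and every $f\in H^k_\mu(\Lambda)$ with values in $\mathbb R^m$ there is a matrix $W_{\mathcal T}\in\mathbf M(m,P^L)$ with $$\|f-W_{\mathcal T}\mathcal T\|_{L^2_\mu(\Lambda)}\ \le\ C\,N^{-k}\,\|f\|_{H^k_\mu(\Lambda)}.$$ (For $N=0$, $N^{-k}$ is $+\infty$ if $k\ge1$ and $1$ if $k=0$, and $\infty\cdot 0=0$.) Equivalently, with $\sigma=\tanh$ acting entry-wise, so that $\sigma(c)\in\Lambda$ for every cell state $c\in\mathbb R^h$: for every measure $\nu$ on $\mathbb R^h$ whose image under $\sigma$ is $\mu$, the $L^2_\nu$ norm of $c\mapsto f(\sigma(c))-W_{\mathcal T}\mathcal T(\sigma(c))$ satisfies the same bound. -/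

import Mathlib

open MeasureTheory

namespace TensorLSTM

noncomputable section

/-- The open cube `Λ = (-1, 1)^h`. -/
def cube (h : ℕ) : Set (Fin h → ℝ) :=
  Set.univ.pi fun _ => Set.Ioo (-1 : ℝ) 1

/-- The entry-wise activation `σ = tanh`, which maps `ℝ^h` bijectively onto `Λ`. -/
def activation {h : ℕ} (c : Fin h → ℝ) : Fin h → ℝ :=
  fun j => Real.tanh (c j)

/-! ### Admissible measures on the cube -/

/-- The tensor-product Jacobi measure on `Λ`, whose Lebesgue density is
`∏ j, (1 - x j) ^ α j * (1 + x j) ^ β j`. Legendre is `α = β = 0`, Chebyshev is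
`α = β = -1/2`. -/
def jacobiMeasure {h : ℕ} (α β : Fin h → ℝ) : Measure (Fin h → ℝ) :=
  (volume.restrict (cube h)).withDensity fun x =>
    ENNReal.ofReal (∏ j, (1 - x j) ^ α j * (1 + x j) ^ β j)

/-- `μ` is a measure on `Λ` of Jacobi type: up to positive constant factors, it is a
tensor-product Jacobi measure with exponents `> -1`. -/
def IsJacobiType {h : ℕ} (μ : Measure (Fin h → ℝ)) : Prop :=
  ∃ α β : Fin h → ℝ, (∀ j, -1 < α j) ∧ (∀ j, -1 < β j) ∧
    ∃ a b : NNReal, 0 < a ∧ a • jacobiMeasure α β ≤ μ ∧ μ ≤ b • jacobiMeasure α β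

/-! ### Weak derivatives and weighted Sobolev spaces -/

/-- The `j`-th partial derivative. -/
def partialDeriv {h : ℕ} (j : Fin h) (φ : (Fin h → ℝ) → ℝ) : (Fin h → ℝ) → ℝ :=
  fun x => fderiv ℝ φ x (Pi.single j 1)

/-- The classical partial derivative `∂^{(i)} φ` for a multi-index `i`. -/
def multiDeriv {h : ℕ} (i : Fin h → ℕ) (φ : (Fin h → ℝ) → ℝ) : (Fin h → ℝ) → ℝ :=
  (List.finRange h).foldr (fun j ψ => (partialDeriv j)^[i j] ψ) φ

/-- `g` is the `i`-th weak derivative of `f` on `Λ`. -/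
def IsWeakDeriv {h : ℕ} {E : Type*} [NormedAddCommGroup E] [NormedSpace ℝ E]
    (i : Fin h → ℕ) (f g : (Fin h → ℝ) → E) : Prop :=
  LocallyIntegrableOn f (cube h) ∧ LocallyIntegrableOn g (cube h) ∧
    ∀ φ : (Fin h → ℝ) → ℝ, ContDiff ℝ ((⊤ : ℕ∞) : WithTop ℕ∞) φ → HasCompactSupport φ →
      tsupport φ ⊆ cube h →
      ∫ x in cube h, multiDeriv i φ x • f x =
        (-1 : ℝ) ^ (∑ j, i j) • ∫ x in cube h, φ x • g x

open Classical in
/-- The `i`-th weak derivative of `f` on `Λ` (unique up to null sets); `0` if there is none. -/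
def weakDeriv {h : ℕ} {E : Type*} [NormedAddCommGroup E] [NormedSpace ℝ E]
    (i : Fin h → ℕ) (f : (Fin h → ℝ) → E) : (Fin h → ℝ) → E :=
  if H : ∃ g, IsWeakDeriv i f g then H.choose else 0

/-- Membership in `H^k_μ(Λ)`: `f` is in `L²_μ` and all weak derivatives of order at most `k`
exist and are in `L²_μ`. -/
def MemSobolev {h : ℕ} {E : Type*} [NormedAddCommGroup E] [NormedSpace ℝ E]
    (k : ℕ) (μ : Measure (Fin h → ℝ)) (f : (Fin h → ℝ) → E) : Prop :=
  MemLp f 2 μ ∧ ∀ i : Fin h → ℕ, ∑ j, i j ≤ k →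
    (∃ g, IsWeakDeriv i f g) ∧ MemLp (weakDeriv i f) 2 μ

/-- The Sobolev norm `∑_{|i| ≤ k} ‖∂^{(i)} f‖_{L²_μ}`. -/
def sobolevNorm {h : ℕ} {E : Type*} [NormedAddCommGroup E] [NormedSpace ℝ E]
    (k : ℕ) (μ : Measure (Fin h → ℝ)) (f : (Fin h → ℝ) → E) : ENNReal :=
  ∑ n ∈ Finset.range (k + 1), ∑ i ∈ Finset.piAntidiag (Finset.univ : Finset (Fin h)) n,
    eLpNorm (weakDeriv i f) 2 μ

/-! ### Tensorized state propagation -/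

/-- The local covector `1 ⊕ W y`. -/
def localVec {h Q : ℕ} (W : Matrix (Fin Q) (Fin h) ℝ) (y : Fin h → ℝ) : Fin (Q + 1) → ℝ :=
  Fin.cons 1 (W.mulVec y)

/-- The coordinates of the rank-`L` tensor `𝒯(y) = ⨂ l, (1 ⊕ W l y)`; there are `P ^ L` of
them, where `P = Q + 1`. -/
def tensorFeature {h L Q : ℕ} (W : Fin L → Matrix (Fin Q) (Fin h) ℝ) (y : Fin h → ℝ) :
    (Fin L → Fin (Q + 1)) → ℝ :=
  fun s => ∏ l, localVec (W l) y (s l)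

/-- The linear read-out `W_𝒯 𝒯(y)`, with values in `ℝ^m` with the Euclidean norm. -/
def propagation {h L Q m : ℕ} (W : Fin L → Matrix (Fin Q) (Fin h) ℝ)
    (WT : Matrix (Fin m) (Fin L → Fin (Q + 1)) ℝ) (y : Fin h → ℝ) : EuclideanSpace ℝ (Fin m) :=
  WithLp.toLp 2 (WT.mulVec (tensorFeature W y))

/-- The guaranteed polynomial order `N = min(L, ⌊L (P - 1) / h⌋)`. -/
def polyOrder (h L P : ℕ) : ℕ :=
  min L (L * (P - 1) / h)

end

end TensorLSTM

namespace TensorLSTM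

/-! ### Spanning the polynomials of bounded total degree -/

/-! The estimate splits into an algebraic fact about the tensor features and a Jackson estimate for
polynomials in weighted `L²`; the weights depend only on `h`, `L`, `P`, never on `f`.

Algebra. Number the `L * Q` rows (`Q = P - 1`) so that consecutive numbers lie in cyclically
consecutive layers, and give each coordinate `N` consecutive rows. Since `N ≤ L`, these lie in `N`
distinct layers. A monomial of degree at most `N` is then built greedily: each new factor finds a
layer not yet used, and unused layers contribute the entry `1`. Hence read-outs realise every
polynomial of total degree at most `N` (`exists_readout_of_totalDegree_le`).

Analysis. By comparability of norms `μ` may be replaced by a Jacobi measure, for which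
tensor-product Jacobi polynomials form a Hilbert basis (Stone–Weierstrass). With the Rodrigues
normalization, integration by parts identifies, up to sign, the integral of `u` against the
polynomial of index `n + e_j` with the integral of `∂_j u` against the polynomial of index `n` for
the weight whose `j`-th exponents are raised by one (`integral_tensorJacobi_weakPartial`). The
squared norms of these polynomials differ by the factor `(n_j + 1) (n_j + A_j + B_j + 2)`, so each
derivative gains about `n_j⁻²` in the squared normalized coefficient (`coeffSq_add_single`).

After `k` derivatives Bessel's inequality in the raised weight, which is pointwise smaller, bounds
the tail. Truncating to `n_j ≤ N / h` keeps the total degree at most `N`, and every discarded index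
has some `n_j > N / h`; this gives `N ^ (-k)` (`exists_mvPolynomial_approx`). Vector values are
treated componentwise, with squares added so that the constant does not depend on `m`. -/

/-- Weight matrices whose rows are coordinate vectors, each coordinate occurring in `N`
consecutive slots when the slots are numbered row by row across the `L` layers. -/
def coordinateWeights (h L Q N : ℕ) (l : Fin L) : Matrix (Fin Q) (Fin h) ℝ :=
  fun q j => if (q * L + l : ℕ) / N = j then 1 else 0

theorem coordinateWeights_mulVec {h L Q N : ℕ} (hN : 0 < N) {j : Fin h} {r : ℕ} (hr : r < N)
    {l : Fin L} {q : Fin Q} (hql : (q * L + l : ℕ) = j * N + r) (y : Fin h → ℝ) :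
    (coordinateWeights h L Q N l).mulVec y q = y j := by
  have hdiv : (j * N + r : ℕ) / N = j := by
    rw [mul_comm, Nat.mul_add_div hN, Nat.div_eq_of_lt hr, add_zero]
  simp [Matrix.mulVec, dotProduct, coordinateWeights, hql, hdiv, Fin.val_inj]

/-- Pigeonhole: the `N` consecutive slots of coordinate `j` have distinct residues mod `L` because
`N ≤ L`, so they occupy `N` different layers and `T` cannot contain them all. -/
theorem exists_free_layer {h L Q N : ℕ} (hNL : N ≤ L) (hNQ : h * N ≤ L * Q) (j : Fin h)
    (T : Finset (Fin L)) (hT : T.card < N) :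
    ∃ l ∉ T, ∃ q : Fin Q, ∃ r < N, (q * L + l : ℕ) = j * N + r := by
  have hL : 0 < L := by omega
  let g : Fin N → Fin L := fun r => ⟨(j * N + r) % L, Nat.mod_lt _ hL⟩
  have hg : Function.Injective g := by
    intro r r' hrr
    have h1 : (j * N + r : ℕ) ≡ j * N + r' [MOD L] := congrArg Fin.val hrr
    have h2 : (r : ℕ) ≡ r' [MOD L] := Nat.ModEq.add_left_cancel' _ h1
    exact Fin.ext (Nat.ModEq.eq_of_lt_of_lt h2 (by omega) (by omega))
  obtain ⟨l, hl, hlT⟩ := Finset.exists_mem_notMem_of_card_lt_card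
    (s := T) (t := Finset.univ.image g) (by
      rw [Finset.card_image_of_injective _ hg]; simpa using hT)
  obtain ⟨r, -, rfl⟩ := Finset.mem_image.1 hl
  -- The slot number is below `h * N ≤ L * Q`, so its quotient by `L` is a legitimate row index.
  have hlt : (j * N + r : ℕ) < L * Q := by
    have : (j + 1 : ℕ) * N ≤ h * N := Nat.mul_le_mul_right _ j.2
    have := r.2
    nlinarith
  refine ⟨g r, hlT, ⟨(j * N + r) / L, Nat.div_lt_of_lt_mul hlt⟩, r, r.2, ?_⟩
  simpa [g] using Nat.div_add_mod' (j * N + r : ℕ) L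

/-- Greedy construction. A layer with `s l = 0` contributes the factor `1` and is still free; the
count of used layers is carried through the induction to guarantee that a free one remains. -/
theorem exists_tensorFeature_eq_prod {h L Q N : ℕ} (hNL : N ≤ L) (hNQ : h * N ≤ L * Q)
    (js : List (Fin h)) (hjs : js.length ≤ N) :
    ∃ s : Fin L → Fin (Q + 1), (Finset.univ.filter fun l => s l ≠ 0).card ≤ js.length ∧
      ∀ y, tensorFeature (coordinateWeights h L Q N) y s = (js.map y).prod := by
  induction js with
  | nil => exact ⟨fun _ => 0, by simp, fun y => by simp [tensorFeature, localVec]⟩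
  | cons j js ih =>
    rw [List.length_cons] at hjs
    obtain ⟨s, hs, hprod⟩ := ih (by omega)
    obtain ⟨l, hl, q, r, hr, hql⟩ := exists_free_layer hNL hNQ j
      (Finset.univ.filter fun l => s l ≠ 0) (by omega)
    have hl0 : s l = 0 := by simpa using hl
    refine ⟨Function.update s l q.succ, ?_, fun y => ?_⟩
    · have : (Finset.univ.filter fun i => Function.update s l q.succ i ≠ 0) ⊆
          insert l (Finset.univ.filter fun i => s i ≠ 0) := by
        intro i hi
        by_cases hil : i = l
        · simp [hil]
        · simpa [hil] using hi
      grw [this, Finset.card_insert_le, hs]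
      simp
    · rw [List.map_cons, List.prod_cons, ← hprod y, tensorFeature, tensorFeature,
        ← Finset.mul_prod_erase _ _ (Finset.mem_univ l),
        ← Finset.mul_prod_erase (a := l) _ (fun i => localVec _ y (s i)) (Finset.mem_univ l)]
      have h1 : localVec (coordinateWeights h L Q N l) y (s l) = 1 := by simp [hl0, localVec]
      have h2 : localVec (coordinateWeights h L Q N l) y (Function.update s l q.succ l) = y j := by
        simpa [localVec] using coordinateWeights_mulVec (by omega) hr hql y
      rw [h1, h2, one_mul]
      congr 1
      refine Finset.prod_congr rfl fun i hi => ?_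
      rw [Function.update_of_ne (Finset.ne_of_mem_erase hi)]

theorem exists_readout_of_totalDegree_le {h L Q N : ℕ} (hNL : N ≤ L) (hNQ : h * N ≤ L * Q)
    (p : MvPolynomial (Fin h) ℝ) (hp : p.totalDegree ≤ N) :
    ∃ c : (Fin L → Fin (Q + 1)) → ℝ,
      ∀ y, ∑ s, c s * tensorFeature (coordinateWeights h L Q N) y s = MvPolynomial.eval y p := by
  classical
  have hmon : ∀ d ∈ p.support, ∃ s : Fin L → Fin (Q + 1), ∀ y,
      tensorFeature (coordinateWeights h L Q N) y s = ∏ j, y j ^ d j := by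
    intro d hd
    obtain ⟨s, -, hs⟩ := exists_tensorFeature_eq_prod hNL hNQ d.toMultiset.toList (by
      rw [Multiset.length_toList, Finsupp.card_toMultiset]
      exact (MvPolynomial.le_totalDegree hd).trans hp)
    refine ⟨s, fun y => ?_⟩
    rw [hs, ← Multiset.prod_coe, ← Multiset.map_coe, Multiset.coe_toList,
      Finset.prod_multiset_map_count]
    simp_rw [Finsupp.count_toMultiset]
    refine Finset.prod_subset (Finset.subset_univ _) fun j _ hj => ?_
    simp_all
  choose! s hs using hmon
  -- Summing over all `d` with `s d = t` makes injectivity of `s` unnecessary.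
  refine ⟨fun t => ∑ d ∈ p.support, if s d = t then p.coeff d else 0, fun y => ?_⟩
  rw [MvPolynomial.eval_eq']
  simp_rw [Finset.sum_mul]
  rw [Finset.sum_comm]
  refine Finset.sum_congr rfl fun d hd => ?_
  rw [← hs d hd y]
  simp [ite_mul]

end TensorLSTM

namespace TensorLSTM

open Polynomial in
/-- The operator `S` with `(w_{a+1,b+1} q)' = w_{a,b} S q`, where `w_{a,b}` is the Jacobi weight. -/
noncomputable def rodriguesStep (a b : ℝ) (q : ℝ[X]) : ℝ[X] :=
  (1 - X ^ 2) * derivative q + (C (b - a) - C (a + b + 2) * X) * q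

open Polynomial in
/-- The Jacobi polynomials, normalized by their Rodrigues formula. -/
noncomputable def jacobiPoly : ℕ → ℝ → ℝ → ℝ[X]
  | 0, _, _ => 1
  | n + 1, a, b => rodriguesStep a b (jacobiPoly n (a + 1) (b + 1))

/-- The univariate Jacobi weight. -/
noncomputable def jacobiWeight (a b t : ℝ) : ℝ := (1 - t) ^ a * (1 + t) ^ b

/-! ### Univariate Jacobi polynomials -/

section Univariate

open Polynomial Set

variable {a b t : ℝ}

theorem jacobiWeight_pos (ht : t ∈ Ioo (-1 : ℝ) 1) : 0 < jacobiWeight a b t :=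
  mul_pos (Real.rpow_pos_of_pos (by linarith [ht.2]) _)
    (Real.rpow_pos_of_pos (by linarith [ht.1]) _)

theorem measurable_jacobiWeight : Measurable (jacobiWeight a b) := by
  unfold jacobiWeight; fun_prop

theorem jacobiWeight_add_one (ht : t ∈ Ioo (-1 : ℝ) 1) :
    jacobiWeight (a + 1) (b + 1) t = (1 - t ^ 2) * jacobiWeight a b t := by
  unfold jacobiWeight
  rw [Real.rpow_add_one (by linarith [ht.2]), Real.rpow_add_one (by linarith [ht.1])]
  ring

theorem integrableOn_jacobiWeight (ha : -1 < a) (hb : -1 < b) :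
    IntegrableOn (jacobiWeight a b) (Ioo (-1) 1) := by
  have h1 : IntegrableOn (fun t : ℝ => (1 - t) ^ a) (Ioo (-1) 1) := by
    have := (intervalIntegral.intervalIntegrable_rpow' (a := 2) (b := 0) ha).comp_sub_left 1
    norm_num at this
    exact (intervalIntegrable_iff_integrableOn_Ioo_of_le (by norm_num)).1 this
  have h2 : IntegrableOn (fun t : ℝ => (1 + t) ^ b) (Ioo (-1) 1) := by
    have := (intervalIntegral.intervalIntegrable_rpow' (a := 0) (b := 2) hb).comp_add_left 1
    norm_num at this
    exact (intervalIntegrable_iff_integrableOn_Ioo_of_le (by norm_num)).1 this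
  -- At most one factor of the weight is singular on each half of the interval; the other has its
  -- base in `[1, 2]` and is bounded for either sign of the exponent.
  have key : ∀ s c : ℝ, 1 ≤ s → s ≤ 2 → s ^ c ≤ 1 + 2 ^ c := by
    intro s c h1 h2
    rcases le_total 0 c with hc | hc
    · linarith [Real.rpow_le_rpow (by linarith) h2 hc]
    · have := Real.rpow_le_one_of_one_le_of_nonpos h1 hc
      have : (0 : ℝ) ≤ 2 ^ c := by positivity
      linarith
  refine Integrable.mono' ((h1.const_mul (1 + 2 ^ b)).add (h2.const_mul (1 + 2 ^ a)))
    measurable_jacobiWeight.aestronglyMeasurable ?_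
  refine (ae_restrict_iff' measurableSet_Ioo).2 (.of_forall fun t ht => ?_)
  rw [Real.norm_of_nonneg (jacobiWeight_pos ht).le]
  have p1 : 0 ≤ (1 - t) ^ a := Real.rpow_nonneg (by linarith [ht.2]) _
  have p2 : 0 ≤ (1 + t) ^ b := Real.rpow_nonneg (by linarith [ht.1]) _
  have p3 : (0 : ℝ) ≤ 2 ^ a := by positivity
  have p4 : (0 : ℝ) ≤ 2 ^ b := by positivity
  simp only [jacobiWeight, Pi.add_apply]
  rcases le_total 0 t with h | h
  · have := key (1 + t) b (by linarith) (by linarith [ht.2])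
    nlinarith [mul_le_mul_of_nonneg_left this p1, mul_nonneg p3 p2]
  · have := key (1 - t) a (by linarith) (by linarith [ht.1])
    nlinarith [mul_le_mul_of_nonneg_left this p2, mul_nonneg p4 p1]

theorem integrableOn_jacobiWeight_mul (ha : -1 < a) (hb : -1 < b) {g : ℝ → ℝ} (hg : Continuous g) :
    IntegrableOn (fun t => jacobiWeight a b t * g t) (Ioo (-1) 1) := by
  have h1 := (integrableOn_jacobiWeight ha hb)
  obtain ⟨M, hM⟩ := (isCompact_Icc (a := (-1 : ℝ)) (b := 1)).exists_bound_of_continuousOn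
    hg.continuousOn
  refine h1.mul_bdd (c := M) hg.aestronglyMeasurable ?_
  exact (ae_restrict_iff' measurableSet_Ioo).2 (.of_forall fun t ht => hM t (Ioo_subset_Icc_self ht))

theorem hasDerivAt_jacobiWeight_mul (q : ℝ[X]) (ht : t ∈ Ioo (-1 : ℝ) 1) :
    HasDerivAt (fun t => jacobiWeight (a + 1) (b + 1) t * q.eval t)
      (jacobiWeight a b t * (rodriguesStep a b q).eval t) t := by
  have h1 : HasDerivAt (fun t : ℝ => (1 - t) ^ (a + 1)) (-1 * (a + 1) * (1 - t) ^ a) t := by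
    simpa using ((hasDerivAt_id t).const_sub 1).rpow_const (p := a + 1)
      (Or.inl (by simp only [id]; linarith [ht.2]))
  have h2 : HasDerivAt (fun t : ℝ => (1 + t) ^ (b + 1)) (1 * (b + 1) * (1 + t) ^ b) t := by
    simpa using ((hasDerivAt_id t).const_add 1).rpow_const (p := b + 1)
      (Or.inl (by simp only [id]; linarith [ht.1]))
  refine ((h1.mul h2).mul (q.hasDerivAt t)).congr_deriv ?_
  simp only [jacobiWeight, rodriguesStep, Pi.mul_apply]
  rw [Real.rpow_add_one (by linarith [ht.1]), Real.rpow_add_one (by linarith [ht.2])]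
  simp
  ring

theorem rodriguesStep_mul (q p : ℝ[X]) :
    rodriguesStep a b (q * p) = rodriguesStep a b q * p + (1 - X ^ 2) * q * derivative p := by
  simp [rodriguesStep]; ring

/-- The integrand is the derivative of `w_{a+1,b+1} q`, which vanishes at `±1` because `a + 1` and
`b + 1` are positive. -/
theorem integral_rodriguesStep (ha : -1 < a) (hb : -1 < b) (q : ℝ[X]) :
    ∫ t in Ioo (-1) 1, jacobiWeight a b t * (rodriguesStep a b q).eval t = 0 := by
  have hint := integrableOn_jacobiWeight_mul ha hb (rodriguesStep a b q).continuous
  have hcont : ContinuousOn (fun t => jacobiWeight (a + 1) (b + 1) t * q.eval t) (Icc (-1) 1) := by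
    unfold jacobiWeight
    refine Continuous.continuousOn ?_
    refine ((Continuous.rpow_const (by fun_prop) fun _ => Or.inr (by linarith)).mul
      (Continuous.rpow_const (by fun_prop) fun _ => Or.inr (by linarith))).mul q.continuous
  have := intervalIntegral.integral_eq_sub_of_hasDerivAt_of_le (by norm_num : (-1 : ℝ) ≤ 1) hcont
    (fun t ht => hasDerivAt_jacobiWeight_mul q ht)
    ((intervalIntegrable_iff_integrableOn_Ioo_of_le (by norm_num)).2 hint)
  rw [intervalIntegral.integral_of_le (by norm_num), integral_Ioc_eq_integral_Ioo] at this
  rw [this]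
  simp [jacobiWeight, Real.zero_rpow (by linarith : a + 1 ≠ 0),
    Real.zero_rpow (by linarith : b + 1 ≠ 0)]

/-- The Jacobi-weighted integral over `(-1, 1)`. -/
noncomputable def jacobiIntegral (a b : ℝ) (p : ℝ[X]) : ℝ :=
  ∫ t in Ioo (-1 : ℝ) 1, jacobiWeight a b t * p.eval t

theorem jacobiIntegral_add (ha : -1 < a) (hb : -1 < b) (p q : ℝ[X]) :
    jacobiIntegral a b (p + q) = jacobiIntegral a b p + jacobiIntegral a b q := by
  simp only [jacobiIntegral, eval_add, mul_add]
  exact integral_add (integrableOn_jacobiWeight_mul ha hb p.continuous)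
    (integrableOn_jacobiWeight_mul ha hb q.continuous)

theorem jacobiIntegral_C_mul (c : ℝ) (p : ℝ[X]) :
    jacobiIntegral a b (C c * p) = c * jacobiIntegral a b p := by
  simp only [jacobiIntegral, eval_mul, eval_C, mul_left_comm _ c]
  exact integral_const_mul _ _

/-- Integration by parts: by the product rule the two sides differ by the integral of `w_{a,b} S(q
p)`, which is zero. Raising the exponents absorbs the factor `1 - t²`. -/
theorem jacobiIntegral_rodriguesStep_mul (ha : -1 < a) (hb : -1 < b) (q p : ℝ[X]) :
    jacobiIntegral a b (rodriguesStep a b q * p) =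
      -jacobiIntegral (a + 1) (b + 1) (q * derivative p) := by
  have h1 : jacobiIntegral (a + 1) (b + 1) (q * derivative p) =
      jacobiIntegral a b ((1 - X ^ 2) * q * derivative p) := by
    refine setIntegral_congr_fun measurableSet_Ioo fun t ht => ?_
    simp only [jacobiWeight_add_one ht, eval_mul, eval_sub, eval_pow, eval_X, eval_one]
    ring
  rw [h1, eq_neg_iff_add_eq_zero, ← jacobiIntegral_add ha hb, ← rodriguesStep_mul]
  exact integral_rodriguesStep ha hb _

theorem coeff_rodriguesStep {q : ℝ[X]} {n : ℕ} (hq : q.natDegree ≤ n) :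
    (rodriguesStep a b q).coeff (n + 1) = -(n + a + b + 2) * q.coeff n := by
  have h0 : q.coeff (n + 1) = 0 := coeff_eq_zero_of_natDegree_lt (by omega)
  have h00 : q.coeff (n + 1 + 1) = 0 := coeff_eq_zero_of_natDegree_lt (by omega)
  have h1 : rodriguesStep a b q = derivative q - X * (X * derivative q) +
      (C (b - a) * q - C (a + b + 2) * (X * q)) := by
    simp only [rodriguesStep]; ring
  rw [h1]
  have h2 : (X * (X * derivative q)).coeff (n + 1) = n * q.coeff n := by
    rw [coeff_X_mul]
    cases n with
    | zero => simp
    | succ n => rw [coeff_X_mul, coeff_derivative]; push_cast; ring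
  simp only [coeff_add, coeff_sub, coeff_C_mul, h2, coeff_X_mul, coeff_derivative, h0, h00]
  ring

theorem natDegree_rodriguesStep_le {q : ℝ[X]} {n : ℕ} (hq : q.natDegree ≤ n) :
    (rodriguesStep a b q).natDegree ≤ n + 1 := by
  have h1 : rodriguesStep a b q = derivative q - X * (X * derivative q) +
      (C (b - a) * q - C (a + b + 2) * (X * q)) := by
    simp only [rodriguesStep]; ring
  rw [h1, natDegree_le_iff_coeff_eq_zero]
  intro m hm
  obtain ⟨m, rfl⟩ : ∃ k, m = k + 2 := ⟨m - 2, by omega⟩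
  have e : ∀ i, n < i → q.coeff i = 0 := fun i hi => coeff_eq_zero_of_natDegree_lt (by omega)
  simp only [coeff_add, coeff_sub, coeff_C_mul, coeff_X_mul, coeff_derivative]
  simp [e (m + 2 + 1) (by omega), e (m + 1) (by omega), e (m + 2) (by omega)]

theorem natDegree_jacobiPoly_le (n : ℕ) (a b : ℝ) : (jacobiPoly n a b).natDegree ≤ n := by
  induction n generalizing a b with
  | zero => simp [jacobiPoly]
  | succ n ih => exact natDegree_rodriguesStep_le (ih _ _)

theorem coeff_jacobiPoly_succ (n : ℕ) (a b : ℝ) :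
    (jacobiPoly (n + 1) a b).coeff (n + 1) =
      -(n + a + b + 2) * (jacobiPoly n (a + 1) (b + 1)).coeff n :=
  coeff_rodriguesStep (natDegree_jacobiPoly_le _ _ _)

theorem coeff_jacobiPoly_ne_zero (n : ℕ) (ha : -1 < a) (hb : -1 < b) :
    (jacobiPoly n a b).coeff n ≠ 0 := by
  induction n generalizing a b with
  | zero => simp [jacobiPoly]
  | succ n ih =>
    rw [coeff_jacobiPoly_succ]
    have : (0 : ℝ) ≤ n := n.cast_nonneg
    exact mul_ne_zero (by linarith) (ih (by linarith) (by linarith))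

theorem degree_jacobiPoly (n : ℕ) (ha : -1 < a) (hb : -1 < b) : (jacobiPoly n a b).degree = n :=
  degree_eq_of_le_of_coeff_ne_zero (natDegree_le_iff_degree_le.1 (natDegree_jacobiPoly_le n a b))
    (coeff_jacobiPoly_ne_zero n ha hb)

/-- Each integration by parts strips one Rodrigues step and differentiates `p`, so the degree bound
drops in step with `n`. -/
theorem jacobiIntegral_jacobiPoly_mul_of_degree_lt {n : ℕ} (ha : -1 < a) (hb : -1 < b) {p : ℝ[X]}
    (hp : p.degree < n) : jacobiIntegral a b (jacobiPoly n a b * p) = 0 := by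
  induction n generalizing a b p with
  | zero =>
    have : p = 0 := by simpa using hp
    simp [this, jacobiIntegral]
  | succ n ih =>
    rw [jacobiPoly, jacobiIntegral_rodriguesStep_mul ha hb, neg_eq_zero]
    rcases eq_or_ne p 0 with rfl | h0
    · simp [jacobiIntegral]
    · refine ih (by linarith) (by linarith) ((degree_derivative_lt h0).trans_le ?_)
      exact natDegree_le_iff_degree_le.1 (Nat.lt_succ_iff.1 ((natDegree_lt_iff_degree_lt h0).2 hp))

theorem jacobiIntegral_jacobiPoly_mul {n m : ℕ} (ha : -1 < a) (hb : -1 < b) (hnm : n ≠ m) :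
    jacobiIntegral a b (jacobiPoly n a b * jacobiPoly m a b) = 0 := by
  rcases hnm.lt_or_gt with h | h
  · rw [mul_comm]
    exact jacobiIntegral_jacobiPoly_mul_of_degree_lt ha hb
      (by rw [degree_jacobiPoly n ha hb]; exact_mod_cast h)
  · exact jacobiIntegral_jacobiPoly_mul_of_degree_lt ha hb
      (by rw [degree_jacobiPoly m ha hb]; exact_mod_cast h)

/-- The squared norm of a Jacobi polynomial in the weighted `L²` space. -/
noncomputable def jacobiNormSq (n : ℕ) (a b : ℝ) : ℝ :=
  jacobiIntegral a b (jacobiPoly n a b * jacobiPoly n a b)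

/-- After one integration by parts, only the leading coefficient of the derivative of `jacobiPoly (n
+ 1) a b` matters: what remains after subtracting `κ` times `jacobiPoly n (a + 1) (b + 1)` has
degree below `n` and is orthogonal to it. -/
theorem jacobiNormSq_succ (n : ℕ) (ha : -1 < a) (hb : -1 < b) :
    jacobiNormSq (n + 1) a b =
      (n + 1) * (n + a + b + 2) * jacobiNormSq n (a + 1) (b + 1) := by
  have ha' : -1 < a + 1 := by linarith
  have hb' : -1 < b + 1 := by linarith
  have key : jacobiNormSq (n + 1) a b = -jacobiIntegral (a + 1) (b + 1)
      (jacobiPoly n (a + 1) (b + 1) * derivative (jacobiPoly (n + 1) a b)) :=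
    jacobiIntegral_rodriguesStep_mul ha hb _ _
  set κ : ℝ := -((n + 1) * (n + a + b + 2)) with hκ
  set r := derivative (jacobiPoly (n + 1) a b) - C κ * jacobiPoly n (a + 1) (b + 1) with hr
  have hdeg : r.degree < n := by
    rw [degree_lt_iff_coeff_zero]
    intro m hm
    have h1 : (derivative (jacobiPoly (n + 1) a b)).natDegree ≤ n :=
      (natDegree_derivative_le _).trans (by have := natDegree_jacobiPoly_le (n + 1) a b; omega)
    rcases hm.eq_or_lt with rfl | hm
    · rw [hr, coeff_sub, coeff_C_mul, coeff_derivative, coeff_jacobiPoly_succ, hκ]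
      ring
    · rw [hr, coeff_sub, coeff_C_mul, coeff_eq_zero_of_natDegree_lt (h1.trans_lt hm),
        coeff_eq_zero_of_natDegree_lt ((natDegree_jacobiPoly_le n _ _).trans_lt hm)]
      ring
  have hsplit : jacobiPoly n (a + 1) (b + 1) * derivative (jacobiPoly (n + 1) a b) =
      C κ * (jacobiPoly n (a + 1) (b + 1) * jacobiPoly n (a + 1) (b + 1)) +
        jacobiPoly n (a + 1) (b + 1) * r := by
    rw [hr]; ring
  rw [key, hsplit, jacobiIntegral_add ha' hb', jacobiIntegral_C_mul,
    jacobiIntegral_jacobiPoly_mul_of_degree_lt ha' hb' hdeg, jacobiNormSq, hκ]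
  ring

theorem jacobiNormSq_pos (n : ℕ) (ha : -1 < a) (hb : -1 < b) : 0 < jacobiNormSq n a b := by
  induction n generalizing a b with
  | zero =>
    simp only [jacobiNormSq, jacobiIntegral, jacobiPoly, mul_one, eval_one]
    rw [setIntegral_pos_iff_support_of_nonneg_ae]
    · have : Ioo (-1 : ℝ) 1 ⊆ Function.support (jacobiWeight a b) :=
        fun t ht => (jacobiWeight_pos ht).ne'
      rw [inter_eq_right.2 this]
      simp
    · exact (ae_restrict_iff' measurableSet_Ioo).2 (.of_forall fun t ht => (jacobiWeight_pos ht).le)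
    · exact integrableOn_jacobiWeight ha hb
  | succ n ih =>
    rw [jacobiNormSq_succ n ha hb]
    have : (0 : ℝ) ≤ n := n.cast_nonneg
    exact mul_pos (mul_pos (by linarith) (by linarith)) (ih (by linarith) (by linarith))

end Univariate
end TensorLSTM

namespace TensorLSTM

/-! ### Tensor-product Jacobi measures -/

section Multivariate

open Set

variable {h : ℕ} {A B : Fin h → ℝ}

theorem jacobiMeasure_eq : jacobiMeasure A B = (volume.restrict (cube h)).withDensity
    fun x => ENNReal.ofReal (∏ j, jacobiWeight (A j) (B j) (x j)) := rfl

theorem measurableSet_cube : MeasurableSet (cube h) :=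
  MeasurableSet.univ_pi fun _ => measurableSet_Ioo

theorem isOpen_cube : IsOpen (cube h) :=
  isOpen_set_pi finite_univ fun _ _ => isOpen_Ioo

theorem measurable_prod_jacobiWeight :
    Measurable fun x : Fin h → ℝ => ∏ j, jacobiWeight (A j) (B j) (x j) :=
  Finset.measurable_fun_prod _ fun _ _ => measurable_jacobiWeight.comp (measurable_pi_apply _)

theorem prod_jacobiWeight_pos {x : Fin h → ℝ} (hx : x ∈ cube h) :
    0 < ∏ j, jacobiWeight (A j) (B j) (x j) :=
  Finset.prod_pos fun j _ => jacobiWeight_pos (hx j trivial)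

theorem jacobiMeasure_absolutelyContinuous :
    jacobiMeasure A B ≪ volume.restrict (cube h) :=
  withDensity_absolutelyContinuous _ _

theorem ae_jacobiMeasure_mem_cube : ∀ᵐ x ∂jacobiMeasure A B, x ∈ cube h :=
  jacobiMeasure_absolutelyContinuous.ae_le (ae_restrict_mem measurableSet_cube)

theorem integral_jacobiMeasure (F : (Fin h → ℝ) → ℝ) :
    ∫ x, F x ∂jacobiMeasure A B =
      ∫ x in cube h, (∏ j, jacobiWeight (A j) (B j) (x j)) * F x := by
  rw [jacobiMeasure_eq, integral_withDensity_eq_integral_toReal_smul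
    measurable_prod_jacobiWeight.ennreal_ofReal (by simp)]
  refine setIntegral_congr_fun measurableSet_cube fun x hx => ?_
  simp only [ENNReal.toReal_ofReal (prod_jacobiWeight_pos hx).le, smul_eq_mul]

theorem integrable_jacobiMeasure_iff {F : (Fin h → ℝ) → ℝ} :
    Integrable F (jacobiMeasure A B) ↔
      IntegrableOn (fun x => (∏ j, jacobiWeight (A j) (B j) (x j)) * F x) (cube h) := by
  rw [jacobiMeasure_eq, integrable_withDensity_iff_integrable_smul'
    measurable_prod_jacobiWeight.ennreal_ofReal (by simp)]
  refine integrableOn_congr_fun (fun x hx => ?_) measurableSet_cube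
  simp only [ENNReal.toReal_ofReal (prod_jacobiWeight_pos hx).le, smul_eq_mul]

theorem restrict_cube : (volume : Measure (Fin h → ℝ)).restrict (cube h) =
    Measure.pi fun _ => volume.restrict (Ioo (-1) 1) := by
  rw [cube, volume_pi, Measure.restrict_pi_pi]

theorem isFiniteMeasure_jacobiMeasure (hA : ∀ j, -1 < A j) (hB : ∀ j, -1 < B j) :
    IsFiniteMeasure (jacobiMeasure A B) := by
  have : Integrable (fun _ => (1 : ℝ)) (jacobiMeasure A B) := by
    rw [integrable_jacobiMeasure_iff, IntegrableOn, restrict_cube]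
    simp only [mul_one]
    exact Integrable.fintype_prod fun j => integrableOn_jacobiWeight (hA j) (hB j)
  simpa [integrable_const_iff, isFiniteMeasure_iff] using this

theorem integral_prod_eval_jacobiMeasure (p : Fin h → Polynomial ℝ) :
    ∫ x, ∏ j, (p j).eval (x j) ∂jacobiMeasure A B = ∏ j, jacobiIntegral (A j) (B j) (p j) := by
  rw [integral_jacobiMeasure, restrict_cube]
  simp_rw [← Finset.prod_mul_distrib]
  exact integral_fintype_prod_eq_prod
    (fun j t => jacobiWeight (A j) (B j) t * (p j).eval t)

theorem cube_subset_Icc : cube h ⊆ Icc (fun _ => (-1 : ℝ)) (fun _ => 1) :=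
  fun _ hx => ⟨fun j => (hx j trivial).1.le, fun j => (hx j trivial).2.le⟩

theorem exists_bound_on_cube {E : Type*} [NormedAddCommGroup E] {F : (Fin h → ℝ) → E} (hF : Continuous F) :
    ∃ M, ∀ x ∈ cube h, ‖F x‖ ≤ M := by
  obtain ⟨M, hM⟩ := (isCompact_Icc (a := (fun _ : Fin h => (-1 : ℝ)))
    (b := fun _ => 1)).exists_bound_of_continuousOn hF.continuousOn
  exact ⟨M, fun x hx => hM x (cube_subset_Icc hx)⟩

theorem memLp_jacobiMeasure_of_continuous (hA : ∀ j, -1 < A j) (hB : ∀ j, -1 < B j)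
    {E : Type*} [NormedAddCommGroup E] {F : (Fin h → ℝ) → E} (hF : Continuous F) :
    MemLp F 2 (jacobiMeasure A B) := by
  have := isFiniteMeasure_jacobiMeasure hA hB
  obtain ⟨M, hM⟩ := exists_bound_on_cube hF
  exact MemLp.of_bound hF.aestronglyMeasurable M (ae_jacobiMeasure_mem_cube.mono hM)

theorem integrable_jacobiMeasure_mul {u F : (Fin h → ℝ) → ℝ}
    (hu : Integrable u (jacobiMeasure A B)) (hF : Continuous F) :
    Integrable (fun x => u x * F x) (jacobiMeasure A B) := by
  obtain ⟨M, hM⟩ := exists_bound_on_cube hF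
  exact hu.mul_bdd (c := M) hF.aestronglyMeasurable (ae_jacobiMeasure_mem_cube.mono hM)

/-! ### The tensor-product Jacobi basis -/

/-- The tensor-product Jacobi polynomial. -/
noncomputable def tensorJacobi (A B : Fin h → ℝ) (n : Fin h → ℕ) : MvPolynomial (Fin h) ℝ :=
  ∏ j, Polynomial.aeval (MvPolynomial.X j) (jacobiPoly (n j) (A j) (B j))

theorem eval_aeval_X (x : Fin h → ℝ) (j : Fin h) (p : Polynomial ℝ) :
    MvPolynomial.eval x (Polynomial.aeval (MvPolynomial.X j) p) = p.eval (x j) := by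
  rw [← MvPolynomial.coe_aeval_eq_eval]
  change MvPolynomial.aeval x _ = _
  rw [← Polynomial.aeval_algHom_apply, MvPolynomial.aeval_X]
  simp [Polynomial.aeval_def, Polynomial.eval₂_eq_eval_map]

theorem eval_tensorJacobi (n : Fin h → ℕ) (x : Fin h → ℝ) :
    MvPolynomial.eval x (tensorJacobi A B n) =
      ∏ j, (jacobiPoly (n j) (A j) (B j)).eval (x j) := by
  simp [tensorJacobi, eval_aeval_X]

theorem totalDegree_aeval_X_le (j : Fin h) (p : Polynomial ℝ) :
    (Polynomial.aeval (MvPolynomial.X j : MvPolynomial (Fin h) ℝ) p).totalDegree ≤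
      p.natDegree := by
  rw [Polynomial.aeval_eq_sum_range]
  refine MvPolynomial.totalDegree_finsetSum_le fun i hi => ?_
  refine (MvPolynomial.totalDegree_smul_le _ _).trans ?_
  rw [MvPolynomial.totalDegree_X_pow]
  simpa [Nat.lt_succ_iff] using hi

theorem totalDegree_tensorJacobi_le (n : Fin h → ℕ) :
    (tensorJacobi A B n).totalDegree ≤ ∑ j, n j :=
  (MvPolynomial.totalDegree_finsetProd _ _).trans <| Finset.sum_le_sum fun j _ =>
    (totalDegree_aeval_X_le j _).trans (natDegree_jacobiPoly_le _ _ _)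

/-- The squared `L²` norm of a tensor-product Jacobi polynomial. -/
noncomputable def tensorNormSq (A B : Fin h → ℝ) (n : Fin h → ℕ) : ℝ :=
  ∏ j, jacobiNormSq (n j) (A j) (B j)

theorem tensorNormSq_pos (hA : ∀ j, -1 < A j) (hB : ∀ j, -1 < B j) (n : Fin h → ℕ) :
    0 < tensorNormSq A B n :=
  Finset.prod_pos fun j _ => jacobiNormSq_pos _ (hA j) (hB j)

theorem integral_tensorJacobi_mul (hA : ∀ j, -1 < A j) (hB : ∀ j, -1 < B j) (n m : Fin h → ℕ) :
    ∫ x, MvPolynomial.eval x (tensorJacobi A B n) * MvPolynomial.eval x (tensorJacobi A B m)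
      ∂jacobiMeasure A B = if n = m then tensorNormSq A B n else 0 := by
  simp_rw [eval_tensorJacobi, ← Finset.prod_mul_distrib, ← Polynomial.eval_mul]
  rw [integral_prod_eval_jacobiMeasure (fun j => jacobiPoly (n j) (A j) (B j) *
    jacobiPoly (m j) (A j) (B j))]
  split_ifs with hnm
  · subst hnm; rfl
  · obtain ⟨j, hj⟩ := Function.ne_iff.1 hnm
    exact Finset.prod_eq_zero (Finset.mem_univ j)
      (jacobiIntegral_jacobiPoly_mul (hA j) (hB j) hj)

/-! ### Completeness of the tensor-product Jacobi polynomials -/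

/-- Linear functionals on polynomials are determined by the tensor-product Jacobi polynomials. -/
theorem linearMap_eq_zero_of_tensorJacobi (hA : ∀ j, -1 < A j) (hB : ∀ j, -1 < B j)
    (Φ : MvPolynomial (Fin h) ℝ →ₗ[ℝ] ℝ) (hΦ : ∀ n, Φ (tensorJacobi A B n) = 0) : Φ = 0 := by
  let S (j : Fin h) : Polynomial.Sequence ℝ :=
    ⟨fun n => jacobiPoly n (A j) (B j), fun n => degree_jacobiPoly n (hA j) (hB j)⟩
  have hS (j : Fin h) (i : ℕ) : IsUnit (S j i).leadingCoeff :=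
    (Polynomial.leadingCoeff_ne_zero.2 ((S j).ne_zero i)).isUnit
  -- The product of one univariate polynomial per variable is multilinear. Exact degrees make the
  -- Jacobi polynomials a basis in each slot, so `Ψ` vanishes; evaluating it at powers of `X`
  -- reaches every monomial.
  let Ψ : MultilinearMap ℝ (fun _ : Fin h => Polynomial ℝ) ℝ :=
    Φ.compMultilinearMap ((MultilinearMap.mkPiAlgebra ℝ (Fin h) (MvPolynomial (Fin h) ℝ)).compLinearMap
      fun j => (Polynomial.aeval (MvPolynomial.X j)).toLinearMap)
  have hΨ : Ψ = 0 := by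
    refine Module.Basis.ext_multilinear (fun j => (S j).basis (hS j)) fun n => ?_
    simpa [Ψ, S, tensorJacobi] using hΦ n
  refine (MvPolynomial.basisMonomials (Fin h) ℝ).ext fun d => ?_
  have := congrArg (fun Θ : MultilinearMap ℝ (fun _ : Fin h => Polynomial ℝ) ℝ =>
    Θ fun j => Polynomial.X ^ d j) hΨ
  simp only [Ψ] at this
  simpa [MvPolynomial.monomial_eq, Finsupp.prod_fintype] using this

theorem exists_mvPolynomial_near {φ : (Fin h → ℝ) → ℝ} (hφ : Continuous φ) {ε : ℝ} (hε : 0 < ε) :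
    ∃ p : MvPolynomial (Fin h) ℝ, ∀ x ∈ cube h, ‖MvPolynomial.eval x p - φ x‖ < ε := by
  let K : Set (Fin h → ℝ) := Icc (fun _ => -1) (fun _ => 1)
  have : CompactSpace K := isCompact_iff_compactSpace.1 isCompact_Icc
  let c (j : Fin h) : C(K, ℝ) := ⟨fun x => x.1 j, (continuous_apply j).comp continuous_subtype_val⟩
  let ev : MvPolynomial (Fin h) ℝ →ₐ[ℝ] C(K, ℝ) := MvPolynomial.aeval c
  have hev (p : MvPolynomial (Fin h) ℝ) (x : K) : ev p x = MvPolynomial.eval x.1 p := by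
    induction p using MvPolynomial.induction_on with
    | C a => simp [ev]
    | add p q hp hq => simp [hp, hq]
    | mul_X p j hp => simp [hp, ev, c]
  have hsep : ev.range.SeparatesPoints := by
    intro x y hxy
    obtain ⟨j, hj⟩ := Function.ne_iff.1 (Subtype.coe_ne_coe.2 hxy)
    exact ⟨c j, ⟨c j, ⟨MvPolynomial.X j, by simp [ev]⟩, rfl⟩, hj⟩
  obtain ⟨⟨-, p, rfl⟩, hg⟩ := ContinuousMap.exists_mem_subalgebra_near_continuous_of_separatesPoints
    ev.range hsep (fun x : K => φ x) (by fun_prop) ε hε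
  refine ⟨p, fun x hx => ?_⟩
  have := hg ⟨x, cube_subset_Icc hx⟩
  rwa [← hev p ⟨x, cube_subset_Icc hx⟩]

/-- Pairing with `u` kills all polynomials, hence by uniform approximation on the bounded cube all
test functions. -/
theorem ae_eq_zero_of_integral_tensorJacobi (hA : ∀ j, -1 < A j) (hB : ∀ j, -1 < B j)
    {u : (Fin h → ℝ) → ℝ} (hu : Integrable u (jacobiMeasure A B))
    (hn : ∀ n, ∫ x, u x * MvPolynomial.eval x (tensorJacobi A B n) ∂jacobiMeasure A B = 0) :
    ∀ᵐ x ∂jacobiMeasure A B, u x = 0 := by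
  have hpoly (p : MvPolynomial (Fin h) ℝ) :
      Integrable (fun x => u x * MvPolynomial.eval x p) (jacobiMeasure A B) :=
    integrable_jacobiMeasure_mul hu (MvPolynomial.continuous_eval p)
  let Φ : MvPolynomial (Fin h) ℝ →ₗ[ℝ] ℝ :=
    { toFun p := ∫ x, u x * MvPolynomial.eval x p ∂jacobiMeasure A B
      map_add' p q := by
        simp only [map_add, mul_add]
        exact integral_add (hpoly p) (hpoly q)
      map_smul' c p := by
        simp only [MvPolynomial.smul_eval, mul_left_comm _ c, RingHom.id_apply, smul_eq_mul]
        exact integral_const_mul _ _ }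
  have hΦ : Φ = 0 := linearMap_eq_zero_of_tensorJacobi hA hB Φ hn
  refine ae_eq_zero_of_integral_contDiff_smul_eq_zero hu.locallyIntegrable fun φ hφ _ => ?_
  refine norm_le_zero_iff.1 (le_of_forall_pos_le_add fun ε hε => ?_)
  set I := ∫ x, ‖u x‖ ∂jacobiMeasure A B
  have hI : 0 ≤ I := integral_nonneg fun _ => norm_nonneg _
  obtain ⟨p, hp⟩ := exists_mvPolynomial_near hφ.continuous (by positivity : 0 < ε / (I + 1))
  have h0 : ∫ x, u x * MvPolynomial.eval x p ∂jacobiMeasure A B = 0 := LinearMap.congr_fun hΦ p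
  have h1 : ∫ x, φ x • u x ∂jacobiMeasure A B =
      ∫ x, (φ x • u x - u x * MvPolynomial.eval x p) ∂jacobiMeasure A B := by
    rw [integral_sub _ (hpoly p), h0, sub_zero]
    simpa [mul_comm] using integrable_jacobiMeasure_mul hu hφ.continuous
  rw [h1, zero_add]
  calc _ ≤ ∫ x, ε / (I + 1) * ‖u x‖ ∂jacobiMeasure A B := by
        refine norm_integral_le_of_norm_le (hu.norm.const_mul _) ?_
        filter_upwards [ae_jacobiMeasure_mem_cube] with x hx
        rw [smul_eq_mul, mul_comm (φ x), ← mul_sub, norm_mul, mul_comm, norm_sub_rev]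
        exact mul_le_mul_of_nonneg_right (hp x hx).le (norm_nonneg _)
    _ = ε / (I + 1) * I := integral_const_mul _ _
    _ ≤ ε := by
        rw [div_mul_eq_mul_div, div_le_iff₀ (by positivity)]
        nlinarith

/-! ### Fourier coefficients, Hilbert basis and truncation -/

/-- The squared Fourier coefficient with respect to the normalized tensor-product Jacobi basis. -/
noncomputable def coeffSq (A B : Fin h → ℝ) (u : (Fin h → ℝ) → ℝ) (n : Fin h → ℕ) : ℝ :=
  (∫ x, u x * MvPolynomial.eval x (tensorJacobi A B n) ∂jacobiMeasure A B) ^ 2 / tensorNormSq A B n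

/-- Polynomials as elements of `L²`. -/
noncomputable def polyToLp (hA : ∀ j, -1 < A j) (hB : ∀ j, -1 < B j) :
    MvPolynomial (Fin h) ℝ →ₗ[ℝ] Lp ℝ 2 (jacobiMeasure A B) where
  toFun p := (memLp_jacobiMeasure_of_continuous hA hB (MvPolynomial.continuous_eval p)).toLp _
  map_add' p q := by
    rw [← MemLp.toLp_add]
    congr 1
    ext x
    simp
  map_smul' c p := by
    rw [RingHom.id_apply, ← MemLp.toLp_const_smul]
    congr 1
    ext x
    simp [MvPolynomial.smul_eval]

/-- The normalized tensor-product Jacobi polynomials as elements of `L²`. -/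
noncomputable def jacobiVec (hA : ∀ j, -1 < A j) (hB : ∀ j, -1 < B j) (n : Fin h → ℕ) :
    Lp ℝ 2 (jacobiMeasure A B) :=
  (√(tensorNormSq A B n))⁻¹ • polyToLp hA hB (tensorJacobi A B n)

theorem inner_toLp {μ : Measure (Fin h → ℝ)} {u v : (Fin h → ℝ) → ℝ} (hu : MemLp u 2 μ)
    (hv : MemLp v 2 μ) : inner ℝ (hu.toLp u) (hv.toLp v) = ∫ x, v x * u x ∂μ := by
  rw [L2.inner_def]
  refine integral_congr_ae ?_
  filter_upwards [hu.coeFn_toLp, hv.coeFn_toLp] with x h1 h2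
  simp [h1, h2]

theorem inner_jacobiVec_toLp (hA : ∀ j, -1 < A j) (hB : ∀ j, -1 < B j) (n : Fin h → ℕ)
    {u : (Fin h → ℝ) → ℝ} (hu : MemLp u 2 (jacobiMeasure A B)) :
    inner ℝ (jacobiVec hA hB n) (hu.toLp u) = (√(tensorNormSq A B n))⁻¹ *
      ∫ x, u x * MvPolynomial.eval x (tensorJacobi A B n) ∂jacobiMeasure A B := by
  rw [jacobiVec, real_inner_smul_left]
  exact congrArg _ (inner_toLp (memLp_jacobiMeasure_of_continuous hA hB
    (MvPolynomial.continuous_eval _)) hu)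

theorem inner_jacobiVec_toLp_sq (hA : ∀ j, -1 < A j) (hB : ∀ j, -1 < B j) (n : Fin h → ℕ)
    {u : (Fin h → ℝ) → ℝ} (hu : MemLp u 2 (jacobiMeasure A B)) :
    (inner ℝ (jacobiVec hA hB n) (hu.toLp u)) ^ 2 = coeffSq A B u n := by
  rw [inner_jacobiVec_toLp, mul_pow, inv_pow, Real.sq_sqrt (tensorNormSq_pos hA hB n).le, coeffSq]
  ring

theorem orthonormal_jacobiVec (hA : ∀ j, -1 < A j) (hB : ∀ j, -1 < B j) :
    Orthonormal ℝ (jacobiVec hA hB) := by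
  rw [orthonormal_iff_ite]
  intro n m
  conv_lhs => rw [jacobiVec.eq_def hA hB m]
  rw [real_inner_smul_right, polyToLp, LinearMap.coe_mk, AddHom.coe_mk, inner_jacobiVec_toLp,
    integral_tensorJacobi_mul hA hB m n]
  by_cases hnm : n = m
  · subst hnm
    have := tensorNormSq_pos hA hB n
    simp only [if_true]
    rw [← mul_assoc, ← mul_inv, Real.mul_self_sqrt this.le, inv_mul_cancel₀ this.ne']
  · simp [hnm, Ne.symm hnm]

/-- The tensor-product Jacobi polynomials form a Hilbert basis. -/
noncomputable def jacobiBasis (hA : ∀ j, -1 < A j) (hB : ∀ j, -1 < B j) :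
    HilbertBasis (Fin h → ℕ) ℝ (Lp ℝ 2 (jacobiMeasure A B)) :=
  HilbertBasis.mkOfOrthogonalEqBot (orthonormal_jacobiVec hA hB) <| by
    have := isFiniteMeasure_jacobiMeasure hA hB
    rw [Submodule.eq_bot_iff]
    intro v hv
    rw [Lp.eq_zero_iff_ae_eq_zero]
    refine ae_eq_zero_of_integral_tensorJacobi hA hB ((Lp.memLp v).integrable (by norm_num)) ?_
    intro n
    have h1 : inner ℝ (jacobiVec hA hB n) v = 0 :=
      (Submodule.mem_orthogonal _ _).1 hv _ (Submodule.subset_span ⟨n, rfl⟩)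
    rw [← Lp.toLp_coeFn v (Lp.memLp v), inner_jacobiVec_toLp] at h1
    exact (mul_eq_zero.1 h1).resolve_left
      (inv_ne_zero (Real.sqrt_pos.2 (tensorNormSq_pos hA hB n)).ne')

theorem norm_toLp_sq {μ : Measure (Fin h → ℝ)} {u : (Fin h → ℝ) → ℝ} (hu : MemLp u 2 μ) :
    ‖hu.toLp u‖ ^ 2 = ∫ x, u x ^ 2 ∂μ := by
  rw [← real_inner_self_eq_norm_sq, inner_toLp]
  simp_rw [sq]

theorem sum_coeffSq_le (hA : ∀ j, -1 < A j) (hB : ∀ j, -1 < B j) {u : (Fin h → ℝ) → ℝ}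
    (hu : MemLp u 2 (jacobiMeasure A B)) (T : Finset (Fin h → ℕ)) :
    ∑ n ∈ T, coeffSq A B u n ≤ ∫ x, u x ^ 2 ∂jacobiMeasure A B := by
  rw [← norm_toLp_sq hu]
  refine le_trans (le_of_eq ?_) ((orthonormal_jacobiVec hA hB).sum_inner_products_le (hu.toLp u)
    (s := T))
  refine Finset.sum_congr rfl fun n _ => ?_
  rw [Real.norm_eq_abs, sq_abs, inner_jacobiVec_toLp_sq]

theorem coeffSq_nonneg (hA : ∀ j, -1 < A j) (hB : ∀ j, -1 < B j) (u : (Fin h → ℝ) → ℝ)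
    (n : Fin h → ℕ) : 0 ≤ coeffSq A B u n :=
  div_nonneg (sq_nonneg _) (tensorNormSq_pos hA hB n).le

/-- The `L²` error of a truncated expansion is controlled by the discarded coefficients. -/
theorem exists_truncation (hA : ∀ j, -1 < A j) (hB : ∀ j, -1 < B j) {u : (Fin h → ℝ) → ℝ}
    (hu : MemLp u 2 (jacobiMeasure A B)) (S : Finset (Fin h → ℕ)) {R : ℝ}
    (hR : ∀ T : Finset (Fin h → ℕ), Disjoint T S → ∑ n ∈ T, coeffSq A B u n ≤ R) :
    ∃ c : (Fin h → ℕ) → ℝ,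
      ∫ x, (u x - MvPolynomial.eval x (∑ n ∈ S, c n • tensorJacobi A B n)) ^ 2
        ∂jacobiMeasure A B ≤ R := by
  classical
  let U := hu.toLp u
  let b := jacobiBasis hA hB
  have hb (n) : b n = jacobiVec hA hB n := by
    simp [b, jacobiBasis]
  let V := U - ∑ n ∈ S, (inner ℝ (b n) U : ℝ) • b n
  have hcoef (n) : inner ℝ (b n) V = if n ∈ S then 0 else (inner ℝ (b n) U : ℝ) := by
    have hon := orthonormal_iff_ite.1 b.orthonormal
    simp only [V, inner_sub_right, inner_sum, real_inner_smul_right, hon]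
    by_cases hn : n ∈ S <;> simp [hn]
  have hV : ‖V‖ ^ 2 ≤ R := by
    have hs := b.hasSum_inner_mul_inner V V
    rw [real_inner_self_eq_norm_sq] at hs
    -- Parseval for the residual `V`: its coefficients vanish on `S` and agree with those of `U`
    -- elsewhere, so each partial sum runs over indices outside `S` and is at most `R`.
    refine hasSum_le_of_sum_le hs fun T => ?_
    refine le_trans (le_of_eq ?_) (hR (T.filter fun n => n ∉ S) ?_)
    · rw [Finset.sum_filter]
      refine Finset.sum_congr rfl fun n _ => ?_
      rw [real_inner_comm, hcoef, hb, ← inner_jacobiVec_toLp_sq hA hB n hu]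
      by_cases hn : n ∈ S <;> simp [hn, sq, U]
    · exact Finset.disjoint_left.2 fun n hn => (Finset.mem_filter.1 hn).2
  refine ⟨fun n => (inner ℝ (b n) U : ℝ) * (√(tensorNormSq A B n))⁻¹, le_trans (le_of_eq ?_) hV⟩
  have hp : MemLp (fun x => MvPolynomial.eval x (∑ n ∈ S, ((inner ℝ (b n) U : ℝ) *
      (√(tensorNormSq A B n))⁻¹) • tensorJacobi A B n)) 2 (jacobiMeasure A B) :=
    memLp_jacobiMeasure_of_continuous hA hB (MvPolynomial.continuous_eval _)
  have hVeq : V = (hu.sub hp).toLp _ := by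
    rw [MemLp.toLp_sub hu hp]
    change _ = U - polyToLp hA hB _
    simp [V, map_sum, hb, jacobiVec, smul_smul]
  rw [hVeq, norm_toLp_sq]
  rfl

end Multivariate
end TensorLSTM

namespace TensorLSTM

/-! ### Smooth cut-off functions on `(-1, 1)` -/

section Cutoff

open Set Filter Topology

/-- A smooth cut-off function, equal to `1` at distance `≥ 2 / m` from `±1` and vanishing at
distance `≤ 1 / m`. -/
noncomputable def cutoff (m t : ℝ) : ℝ :=
  Real.smoothTransition (m * (1 - t) - 1) * Real.smoothTransition (m * (1 + t) - 1)

variable {m t : ℝ}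

theorem contDiff_cutoff (m : ℝ) : ContDiff ℝ ((⊤ : ℕ∞) : WithTop ℕ∞) (cutoff m) :=
  (Real.smoothTransition.contDiff.comp (by fun_prop)).mul
    (Real.smoothTransition.contDiff.comp (by fun_prop))

theorem abs_cutoff_le_one : |cutoff m t| ≤ 1 := by
  rw [cutoff, abs_mul, abs_of_nonneg (Real.smoothTransition.nonneg _),
    abs_of_nonneg (Real.smoothTransition.nonneg _)]
  exact mul_le_one₀ (Real.smoothTransition.le_one _) (Real.smoothTransition.nonneg _)
    (Real.smoothTransition.le_one _)

theorem one_lt_of_cutoff_ne_zero (ht : cutoff m t ≠ 0) : 1 < m * (1 - t) ∧ 1 < m * (1 + t) := by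
  constructor <;> by_contra! hc <;> apply ht <;> unfold cutoff
  · rw [Real.smoothTransition.zero_of_nonpos (by linarith), zero_mul]
  · rw [Real.smoothTransition.zero_of_nonpos (x := m * (1 + t) - 1) (by linarith), mul_zero]

theorem cutoff_eventuallyEq_zero (ht : t ∉ Ioo (-1 : ℝ) 1) (hm : 0 < m) :
    cutoff m =ᶠ[𝓝 t] 0 := by
  have : ∀ᶠ s in 𝓝 t, ¬(1 < m * (1 - s) ∧ 1 < m * (1 + s)) := by
    have hcont1 : Continuous fun s : ℝ => m * (1 - s) := by fun_prop
    have hcont2 : Continuous fun s : ℝ => m * (1 + s) := by fun_prop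
    rcases not_and_or.1 ht with h | h
    · have h0 : m * (1 + t) < 1 := by nlinarith
      filter_upwards [hcont2.continuousAt.eventually_lt_const h0] with s hs using
        fun h => lt_asymm hs h.2
    · have h0 : m * (1 - t) < 1 := by nlinarith
      filter_upwards [hcont1.continuousAt.eventually_lt_const h0] with s hs using
        fun h => lt_asymm hs h.1
  filter_upwards [this] with s hs
  by_contra h
  exact hs (one_lt_of_cutoff_ne_zero h)

theorem cutoff_eventuallyEq_one (h1 : 2 < m * (1 - t)) (h2 : 2 < m * (1 + t)) :
    cutoff m =ᶠ[𝓝 t] fun _ => 1 := by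
  have hcont1 : Continuous fun s : ℝ => m * (1 - s) := by fun_prop
  have hcont2 : Continuous fun s : ℝ => m * (1 + s) := by fun_prop
  filter_upwards [hcont1.continuousAt.eventually_const_lt h1,
    hcont2.continuousAt.eventually_const_lt h2] with s hs1 hs2
  rw [cutoff, Real.smoothTransition.one_of_one_le (by linarith),
    Real.smoothTransition.one_of_one_le (by linarith), one_mul]

theorem eventually_cutoff_eventuallyEq_one (ht : t ∈ Ioo (-1 : ℝ) 1) :
    ∀ᶠ m : ℕ in atTop, cutoff (m + 1) =ᶠ[𝓝 t] fun _ => 1 := by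
  have hm : Tendsto (fun m : ℕ => (m : ℝ) + 1) atTop atTop :=
    tendsto_atTop_add_const_right _ _ tendsto_natCast_atTop_atTop
  filter_upwards [(hm.atTop_mul_const (by linarith [ht.2] : 0 < 1 - t)).eventually_gt_atTop 2,
    (hm.atTop_mul_const (by linarith [ht.1] : 0 < 1 + t)).eventually_gt_atTop 2] with m h1 h2
  exact cutoff_eventuallyEq_one h1 h2

/-- The derivative vanishes for `s > 1`, which leaves a compact interval. The weight `s + 1` becomes
`m * (1 ∓ t)` in `cutoff` and cancels the factor `m` of the chain rule. -/
theorem exists_bound_deriv_smoothTransition :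
    ∃ K, ∀ s : ℝ, -1 ≤ s → (s + 1) * |deriv Real.smoothTransition s| ≤ K := by
  have hc : Continuous (deriv Real.smoothTransition) :=
    (Real.smoothTransition.contDiff (n := 1)).continuous_deriv le_rfl
  obtain ⟨K, hK⟩ := (isCompact_Icc (a := (-1 : ℝ)) (b := 1)).exists_bound_of_continuousOn
    (f := fun s => (s + 1) * |deriv Real.smoothTransition s|) (by fun_prop)
  refine ⟨max K 0, fun s hs => ?_⟩
  rcases le_or_gt s 1 with h | h
  · exact (le_abs_self _).trans ((hK s ⟨hs, h⟩).trans (le_max_left _ _))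
  · have : Real.smoothTransition =ᶠ[𝓝 s] fun _ => 1 := by
      filter_upwards [lt_mem_nhds h] with r hr using Real.smoothTransition.one_of_one_le hr.le
    simp [this.deriv_eq]

/-- Uniformity in `m` is the point: `χ_m'` is of size `m` only at distance of order `1 / m` from
`±1`, where `1 - t²` compensates. This is what permits dominated convergence. -/
theorem exists_bound_deriv_cutoff :
    ∃ K, ∀ m : ℝ, 0 ≤ m → ∀ t ∈ Ioo (-1 : ℝ) 1, (1 - t ^ 2) * |deriv (cutoff m) t| ≤ K := by
  obtain ⟨K, hK⟩ := exists_bound_deriv_smoothTransition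
  refine ⟨4 * K, fun m hm t ht => ?_⟩
  have h1 : 0 < 1 - t := by linarith [ht.2]
  have h2 : 0 < 1 + t := by linarith [ht.1]
  have hd (s : ℝ) : HasDerivAt Real.smoothTransition (deriv Real.smoothTransition s) s :=
    ((Real.smoothTransition.contDiff (n := 1)).differentiable (by norm_num) s).hasDerivAt
  have e1 : HasDerivAt (fun t : ℝ => m * (1 - t) - 1) (m * (-1)) t :=
    (((hasDerivAt_id t).const_sub 1).const_mul m).sub_const 1
  have e2 : HasDerivAt (fun t : ℝ => m * (1 + t) - 1) (m * 1) t :=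
    (((hasDerivAt_id t).const_add 1).const_mul m).sub_const 1
  have := (((hd _).comp t e1).mul ((hd _).comp t e2)).deriv
  change deriv (cutoff m) t = _ at this
  simp only [Function.comp_apply] at this
  rw [this]
  have k1 := hK (m * (1 - t) - 1) (by nlinarith)
  have k2 := hK (m * (1 + t) - 1) (by nlinarith)
  set d1 := deriv Real.smoothTransition (m * (1 - t) - 1)
  set d2 := deriv Real.smoothTransition (m * (1 + t) - 1)
  have s1 := Real.smoothTransition.nonneg (m * (1 - t) - 1)
  have s2 := Real.smoothTransition.nonneg (m * (1 + t) - 1)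
  have s1' := Real.smoothTransition.le_one (m * (1 - t) - 1)
  have s2' := Real.smoothTransition.le_one (m * (1 + t) - 1)
  set σ1 := Real.smoothTransition (m * (1 - t) - 1)
  set σ2 := Real.smoothTransition (m * (1 + t) - 1)
  rw [sub_add_cancel] at k1 k2
  have b1 : |d1 * (m * -1) * σ2| ≤ m * |d1| := by
    rw [abs_mul, abs_mul, mul_neg_one, abs_neg, abs_of_nonneg hm, abs_of_nonneg s2]
    nlinarith [mul_nonneg (abs_nonneg d1) hm]
  have b2 : |σ1 * (d2 * (m * 1))| ≤ m * |d2| := by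
    rw [abs_mul, abs_mul, mul_one, abs_of_nonneg hm, abs_of_nonneg s1]
    nlinarith [mul_nonneg (abs_nonneg d2) hm]
  calc (1 - t ^ 2) * |d1 * (m * -1) * σ2 + σ1 * (d2 * (m * 1))|
      ≤ (1 - t ^ 2) * (m * |d1| + m * |d2|) :=
        mul_le_mul_of_nonneg_left ((abs_add_le _ _).trans (add_le_add b1 b2)) (by nlinarith)
    _ = (1 + t) * (m * (1 - t) * |d1|) + (1 - t) * (m * (1 + t) * |d2|) := by ring
    _ ≤ (1 + t) * K + (1 - t) * K :=
        add_le_add (mul_le_mul_of_nonneg_left k1 h2.le) (mul_le_mul_of_nonneg_left k2 h1.le)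
    _ ≤ 4 * K := by
        have : 0 ≤ K := le_trans (by positivity) k1
        nlinarith

open Polynomial in
/-- The truncated weighted polynomial `χ_m w_{a,b} q`. -/
noncomputable def cutoffWeight (m a b : ℝ) (q : ℝ[X]) (t : ℝ) : ℝ :=
  cutoff m t * (jacobiWeight a b t * q.eval t)

variable {a b : ℝ} {q : Polynomial ℝ}

/-- The real powers are smooth inside the interval; at every other point, endpoints included, the
cut-off vanishes on a whole neighbourhood. -/
theorem contDiff_cutoffWeight (hm : 0 < m) :
    ContDiff ℝ ((⊤ : ℕ∞) : WithTop ℕ∞) (cutoffWeight m a b q) := by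
  rw [contDiff_iff_contDiffAt]
  intro t
  by_cases ht : t ∈ Ioo (-1 : ℝ) 1
  · refine (contDiff_cutoff m).contDiffAt.mul (ContDiffAt.mul (ContDiffAt.mul ?_ ?_) ?_)
    · exact ContDiffAt.rpow_const_of_ne (by fun_prop) (by linarith [ht.2])
    · exact ContDiffAt.rpow_const_of_ne (by fun_prop) (by linarith [ht.1])
    · simpa only [Polynomial.coe_aeval_eq_eval] using (q.contDiff_aeval (𝕜 := ℝ) _).contDiffAt
  · refine (contDiffAt_const (c := (0 : ℝ))).congr_of_eventuallyEq ?_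
    filter_upwards [cutoff_eventuallyEq_zero ht hm] with s hs
    simp [cutoffWeight, hs]

theorem mem_Icc_of_cutoffWeight_ne_zero (hm : 0 < m) (ht : cutoffWeight m a b q t ≠ 0) :
    t ∈ Icc (-1 + m⁻¹) (1 - m⁻¹) := by
  obtain ⟨h1, h2⟩ := one_lt_of_cutoff_ne_zero (left_ne_zero_of_mul ht)
  have hmm : m * m⁻¹ = 1 := mul_inv_cancel₀ hm.ne'
  constructor <;> nlinarith

/-- The derivative of `χ_m w_{a+1,b+1} q`, divided by `w_{a,b}`. -/
noncomputable def cutoffStep (m a b : ℝ) (q : Polynomial ℝ) (t : ℝ) : ℝ :=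
  (1 - t ^ 2) * deriv (cutoff m) t * q.eval t + cutoff m t * (rodriguesStep a b q).eval t

theorem hasDerivAt_cutoffWeight (ht : t ∈ Ioo (-1 : ℝ) 1) :
    HasDerivAt (cutoffWeight m (a + 1) (b + 1) q) (jacobiWeight a b t * cutoffStep m a b q t) t := by
  have h1 : HasDerivAt (cutoff m) (deriv (cutoff m) t) t :=
    ((contDiff_cutoff m).differentiable (by simp) t).hasDerivAt
  refine (h1.mul (hasDerivAt_jacobiWeight_mul q ht)).congr_deriv ?_
  rw [jacobiWeight_add_one ht, cutoffStep]
  ring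

theorem continuous_cutoffStep : Continuous (cutoffStep m a b q) := by
  have h1 : Continuous (deriv (cutoff m)) := (contDiff_cutoff m).continuous_deriv (by simp)
  have h2 := (contDiff_cutoff m).continuous
  unfold cutoffStep
  fun_prop

theorem tendsto_cutoff (ht : t ∈ Ioo (-1 : ℝ) 1) :
    Tendsto (fun m : ℕ => cutoff (m + 1) t) atTop (𝓝 1) :=
  tendsto_const_nhds.congr' <| (eventually_cutoff_eventuallyEq_one ht).mono
    fun _ hm => hm.eq_of_nhds.symm

theorem tendsto_cutoffStep (ht : t ∈ Ioo (-1 : ℝ) 1) :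
    Tendsto (fun m : ℕ => cutoffStep (m + 1) a b q t) atTop
      (𝓝 ((rodriguesStep a b q).eval t)) := by
  refine tendsto_const_nhds.congr' <| (eventually_cutoff_eventuallyEq_one ht).mono fun m hm => ?_
  simp [cutoffStep, hm.deriv_eq, hm.eq_of_nhds]

theorem exists_bound_eval (p : Polynomial ℝ) : ∃ M, ∀ t ∈ Ioo (-1 : ℝ) 1, |p.eval t| ≤ M := by
  obtain ⟨M, hM⟩ := (isCompact_Icc (a := (-1 : ℝ)) (b := 1)).exists_bound_of_continuousOn
    p.continuous.continuousOn
  exact ⟨M, fun t ht => hM t (Ioo_subset_Icc_self ht)⟩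

theorem exists_bound_cutoff_mul (q : Polynomial ℝ) :
    ∃ M, ∀ m : ℕ, ∀ t ∈ Ioo (-1 : ℝ) 1, |cutoff (m + 1) t * q.eval t| ≤ M := by
  obtain ⟨M, hM⟩ := exists_bound_eval q
  refine ⟨M, fun m t ht => ?_⟩
  rw [abs_mul]
  exact (mul_le_of_le_one_left (abs_nonneg _) abs_cutoff_le_one).trans (hM t ht)

theorem exists_bound_cutoffStep (a b : ℝ) (q : Polynomial ℝ) :
    ∃ M, ∀ m : ℕ, ∀ t ∈ Ioo (-1 : ℝ) 1, |cutoffStep (m + 1) a b q t| ≤ M := by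
  obtain ⟨M₁, hM₁⟩ := exists_bound_eval q
  obtain ⟨M₂, hM₂⟩ := exists_bound_cutoff_mul (rodriguesStep a b q)
  obtain ⟨K, hK⟩ := exists_bound_deriv_cutoff
  refine ⟨K * M₁ + M₂, fun m t ht => (abs_add_le _ _).trans (add_le_add ?_ (hM₂ m t ht))⟩
  have h0 : 0 ≤ 1 - t ^ 2 := by nlinarith [ht.1, ht.2]
  rw [abs_mul, abs_mul, abs_of_nonneg h0]
  have := hK (m + 1) (by positivity) t ht
  exact mul_le_mul this (hM₁ t ht) (abs_nonneg _) (le_trans (by positivity) this)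

end Cutoff

/-! ### Fourier coefficients of weak derivatives -/

section WeakDerivative

open Set Filter Topology

variable {h : ℕ} {A B : Fin h → ℝ}

/-- `v` is the weak partial derivative of `u` in direction `j` on the cube. -/
def IsWeakPartial (j : Fin h) (u v : (Fin h → ℝ) → ℝ) : Prop :=
  ∀ φ : (Fin h → ℝ) → ℝ, ContDiff ℝ ((⊤ : ℕ∞) : WithTop ℕ∞) φ → HasCompactSupport φ →
    tsupport φ ⊆ cube h →
    ∫ x in cube h, partialDeriv j φ x * u x = -∫ x in cube h, φ x * v x

theorem tendsto_integral_mul_prod {u : (Fin h → ℝ) → ℝ} (hu : Integrable u (jacobiMeasure A B))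
    (D : ℕ → Fin h → ℝ → ℝ) (hD : ∀ m i, Continuous (D m i)) {M : Fin h → ℝ}
    (hM : ∀ i, ∀ m, ∀ t ∈ Ioo (-1 : ℝ) 1, |D m i t| ≤ M i) (r : Fin h → ℝ → ℝ)
    (hr : ∀ i, ∀ t ∈ Ioo (-1 : ℝ) 1, Tendsto (fun m => D m i t) atTop (𝓝 (r i t))) :
    Tendsto (fun m => ∫ x, u x * ∏ i, D m i (x i) ∂jacobiMeasure A B) atTop
      (𝓝 (∫ x, u x * ∏ i, r i (x i) ∂jacobiMeasure A B)) := by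
  refine tendsto_integral_of_dominated_convergence (fun x => ‖u x‖ * ∏ i, M i) (fun m => ?_)
    (hu.norm.mul_const _) (fun m => ?_) ?_
  · refine hu.aestronglyMeasurable.mul (Continuous.aestronglyMeasurable ?_)
    exact continuous_finsetProd _ fun i _ => (hD m i).comp (continuous_apply i)
  · filter_upwards [ae_jacobiMeasure_mem_cube] with x hx
    rw [norm_mul, norm_prod]
    exact mul_le_mul_of_nonneg_left (Finset.prod_le_prod (fun _ _ => norm_nonneg _)
      fun i _ => hM i m (x i) (hx i trivial)) (norm_nonneg _)
  · filter_upwards [ae_jacobiMeasure_mem_cube] with x hx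
    exact (tendsto_finsetProd _ fun i _ => hr i (x i) (hx i trivial)).const_mul _

theorem tsupport_prod_subset_cube {m : ℝ} (hm : 0 < m) (a b : Fin h → ℝ)
    (q : Fin h → Polynomial ℝ) :
    HasCompactSupport (fun x : Fin h → ℝ => ∏ i, cutoffWeight m (a i) (b i) (q i) (x i)) ∧
      tsupport (fun x : Fin h → ℝ => ∏ i, cutoffWeight m (a i) (b i) (q i) (x i)) ⊆ cube h := by
  set K : Set (Fin h → ℝ) := Icc (fun _ => -1 + m⁻¹) (fun _ => 1 - m⁻¹)
  have hK : Function.support (fun x : Fin h → ℝ =>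
      ∏ i, cutoffWeight m (a i) (b i) (q i) (x i)) ⊆ K := by
    intro x hx
    have := fun i => mem_Icc_of_cutoffWeight_ne_zero hm
      (Finset.prod_ne_zero_iff.1 hx i (Finset.mem_univ i))
    exact ⟨fun i => (this i).1, fun i => (this i).2⟩
  have hKc : K ⊆ cube h := fun x hx i _ => by
    have := inv_pos.2 hm
    have h1 := hx.1 i
    have h2 := hx.2 i
    constructor <;> linarith
  exact ⟨HasCompactSupport.of_support_subset_isCompact isCompact_Icc hK,
    (closure_minimal hK isClosed_Icc).trans hKc⟩

theorem partialDeriv_prod (j : Fin h) (θ : Fin h → ℝ → ℝ) (x : Fin h → ℝ) {d : ℝ}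
    (hθ : ∀ i, DifferentiableAt ℝ (θ i) (x i)) (hd : HasDerivAt (θ j) d (x j)) :
    partialDeriv j (fun x => ∏ i, θ i (x i)) x = ∏ i, if i = j then d else θ i (x i) := by
  have h1 (i : Fin h) : HasFDerivAt (fun x : Fin h → ℝ => θ i (x i))
      (deriv (θ i) (x i) • ContinuousLinearMap.proj (R := ℝ) (φ := fun _ : Fin h => ℝ) i) x :=
    (hθ i).hasDerivAt.comp_hasFDerivAt x (hasFDerivAt_apply i x)
  rw [partialDeriv, (HasFDerivAt.finsetProd (u := Finset.univ) fun i _ => h1 i).fderiv]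
  simp only [_root_.sum_apply, _root_.smul_apply,
    ContinuousLinearMap.proj_apply, smul_eq_mul]
  rw [Finset.sum_eq_single j (fun i _ hij => by simp [hij]) (by simp),
    ← Finset.mul_prod_erase _ _ (Finset.mem_univ j)]
  rw [hd.deriv, Pi.single_eq_same, if_pos rfl, mul_one, mul_comm]
  congr 1
  exact Finset.prod_congr rfl fun i hi => by rw [if_neg (Finset.ne_of_mem_erase hi)]

/-- The raised weight times its Jacobi polynomial is not compactly supported, so it is tested after
multiplication by the cut-offs. Its `j`-th derivative is the original weight times a bounded factor,
whose limit is the Rodrigues step, that is, the polynomial of index `n + e_j`. -/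
theorem integral_tensorJacobi_weakPartial (j : Fin h) {u v : (Fin h → ℝ) → ℝ}
    (huv : IsWeakPartial j u v) (hu : Integrable u (jacobiMeasure A B))
    (hv : Integrable v (jacobiMeasure (A + Pi.single j 1) (B + Pi.single j 1))) (n : Fin h → ℕ) :
    ∫ x, v x * MvPolynomial.eval x (tensorJacobi (A + Pi.single j 1) (B + Pi.single j 1) n)
        ∂jacobiMeasure (A + Pi.single j 1) (B + Pi.single j 1) =
      -∫ x, u x * MvPolynomial.eval x (tensorJacobi A B (n + Pi.single j 1))
        ∂jacobiMeasure A B := by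
  set A' := A + Pi.single j 1 with hA'
  set B' := B + Pi.single j 1 with hB'
  have hAj : A' j = A j + 1 := by simp [hA']
  have hBj : B' j = B j + 1 := by simp [hB']
  have hAi (i) (hi : i ≠ j) : A' i = A i := by simp [hA', hi]
  have hBi (i) (hi : i ≠ j) : B' i = B i := by simp [hB', hi]
  let q (i : Fin h) : Polynomial ℝ := jacobiPoly (n i) (A' i) (B' i)
  let D (m : ℕ) (i : Fin h) (t : ℝ) : ℝ :=
    if i = j then cutoffStep (m + 1) (A i) (B i) (q i) t else cutoff (m + 1) t * (q i).eval t
  have hE (m : ℕ) : ∫ x, u x * ∏ i, D m i (x i) ∂jacobiMeasure A B =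
      -∫ x, v x * ∏ i, (cutoff (m + 1) (x i) * (q i).eval (x i)) ∂jacobiMeasure A' B' := by
    have hm : (0 : ℝ) < m + 1 := by positivity
    obtain ⟨hc, hs⟩ := tsupport_prod_subset_cube hm A' B' q
    have := huv _ (contDiff_prod fun i _ => (contDiff_cutoffWeight hm).comp
      (contDiff_apply ℝ ℝ i)) hc hs
    rw [integral_jacobiMeasure, integral_jacobiMeasure]
    convert this using 1
    · refine setIntegral_congr_fun measurableSet_cube fun x hx => ?_
      have hd : HasDerivAt (cutoffWeight (m + 1) (A' j) (B' j) (q j))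
          (jacobiWeight (A j) (B j) (x j) * cutoffStep (m + 1) (A j) (B j) (q j) (x j)) (x j) := by
        rw [hAj, hBj]
        exact hasDerivAt_cutoffWeight (hx j trivial)
      have hpd := partialDeriv_prod j (fun i => cutoffWeight (m + 1) (A' i) (B' i) (q i)) x
        (fun i => (contDiff_cutoffWeight hm).differentiable (by simp) _) hd
      simp only [Function.comp_apply]
      rw [hpd, mul_left_comm, mul_comm (u x), ← Finset.prod_mul_distrib]
      congr 1
      refine Finset.prod_congr rfl fun i _ => ?_
      by_cases hi : i = j
      · subst hi; simp [D]
      · simp only [D, hi, if_false, cutoffWeight, hAi i hi, hBi i hi]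
        ring
    · congr 1
      refine setIntegral_congr_fun measurableSet_cube fun x hx => ?_
      simp only [Function.comp_apply, cutoffWeight, Finset.prod_mul_distrib]
      ring
  choose M₁ hM₁ using fun i => exists_bound_cutoff_mul (q i)
  choose M₂ hM₂ using fun i => exists_bound_cutoffStep (A i) (B i) (q i)
  have hlim₁ := tendsto_integral_mul_prod hv (fun m i t => cutoff (m + 1) t * (q i).eval t)
    (fun m i => (contDiff_cutoff _).continuous.mul (q i).continuous) hM₁ (fun i t => (q i).eval t)
    (fun i t ht => by simpa using (tendsto_cutoff ht).mul_const ((q i).eval t))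
  have hlim₂ := tendsto_integral_mul_prod hu D
    (fun m i => by
      by_cases hi : i = j
      · simpa [D, hi] using continuous_cutoffStep
      · simp only [D, hi, if_false]
        exact (contDiff_cutoff _).continuous.mul (q i).continuous)
    (M := fun i => if i = j then M₂ i else M₁ i)
    (fun i m t ht => by
      by_cases hi : i = j
      · simpa only [D, hi, if_true] using hM₂ j m t ht
      · simpa only [D, hi, if_false] using hM₁ i m t ht)
    (fun i t => (jacobiPoly ((n + Pi.single j 1 : Fin h → ℕ) i) (A i) (B i)).eval t)
    (fun i t ht => by
      by_cases hi : i = j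
      · subst hi
        simp only [D, if_true, Pi.add_apply, Pi.single_eq_same, jacobiPoly, ← hAj, ← hBj]
        exact tendsto_cutoffStep ht
      · simpa [D, hi, q, hAi i hi, hBi i hi] using (tendsto_cutoff ht).mul_const ((q i).eval t))
  simp_rw [hE] at hlim₂
  have := tendsto_nhds_unique hlim₁.neg hlim₂
  simp only [eval_tensorJacobi]
  rw [← this, neg_neg]

end WeakDerivative
end TensorLSTM

namespace TensorLSTM

/-! ### Polynomial approximation in weighted Sobolev spaces -/

section Approximation

open Set

variable {h : ℕ} {A B : Fin h → ℝ}

theorem neg_one_lt_add_single (hA : ∀ j, -1 < A j) (j : Fin h) {r : ℝ} (hr : 0 ≤ r) (i : Fin h) :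
    -1 < (A + Pi.single j r : Fin h → ℝ) i := by
  have : 0 ≤ (Pi.single j r : Fin h → ℝ) i := by
    by_cases hi : i = j
    · subst hi; simpa
    · simp [hi]
  have := hA i
  rw [Pi.add_apply]
  linarith

theorem tensorNormSq_add_single (hA : ∀ j, -1 < A j) (hB : ∀ j, -1 < B j) (j : Fin h)
    (n : Fin h → ℕ) :
    tensorNormSq A B (n + Pi.single j 1) = (n j + 1) * (n j + A j + B j + 2) *
      tensorNormSq (A + Pi.single j 1) (B + Pi.single j 1) n := by
  simp only [tensorNormSq]
  rw [← Finset.mul_prod_erase _ _ (Finset.mem_univ j),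
    ← Finset.mul_prod_erase (a := j) _ (fun i => jacobiNormSq (n i) _ _) (Finset.mem_univ j),
    ← mul_assoc]
  congr 1
  · simpa using jacobiNormSq_succ (n j) (hA j) (hB j)
  · refine Finset.prod_congr rfl fun i hi => ?_
    simp [Finset.ne_of_mem_erase hi]

/-- Raising both exponents by one multiplies the density by `1 - x_j² ≤ 1`. -/
theorem jacobiMeasure_add_single_le (j : Fin h) (r : ℕ) :
    jacobiMeasure (A + Pi.single j (r : ℝ)) (B + Pi.single j (r : ℝ)) ≤ jacobiMeasure A B := by
  induction r with
  | zero => simp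
  | succ r ih =>
    refine le_trans ?_ ih
    rw [jacobiMeasure_eq, jacobiMeasure_eq]
    refine withDensity_mono ((ae_restrict_iff' measurableSet_cube).2 (.of_forall fun x hx => ?_))
    refine ENNReal.ofReal_le_ofReal (Finset.prod_le_prod
      (fun i _ => (jacobiWeight_pos (hx i trivial)).le) fun i _ => ?_)
    by_cases hi : i = j
    · subst hi
      have h1 := hx i trivial
      simp only [Pi.add_apply, Pi.single_eq_same, Nat.cast_succ, ← add_assoc]
      rw [jacobiWeight_add_one h1]
      exact mul_le_of_le_one_left (jacobiWeight_pos h1).le (by nlinarith [sq_nonneg (x i)])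
    · simp [hi]

/-- The two pairings agree up to sign, so only the ratio of the squared norms remains. -/
theorem coeffSq_add_single (hA : ∀ j, -1 < A j) (hB : ∀ j, -1 < B j) (j : Fin h)
    {u v : (Fin h → ℝ) → ℝ} (huv : IsWeakPartial j u v) (hu : Integrable u (jacobiMeasure A B))
    (hv : Integrable v (jacobiMeasure A B)) (n : Fin h → ℕ) :
    coeffSq A B u (n + Pi.single j 1) =
      coeffSq (A + Pi.single j 1) (B + Pi.single j 1) v n /
        ((n j + 1) * (n j + A j + B j + 2)) := by
  have hle := jacobiMeasure_add_single_le (A := A) (B := B) j 1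
  rw [Nat.cast_one] at hle
  rw [coeffSq, coeffSq, integral_tensorJacobi_weakPartial j huv hu (hv.mono_measure hle) n,
    tensorNormSq_add_single hA hB, neg_sq, div_div, mul_comm]

theorem coeffSq_add_single_le {j : Fin h} {s : ℝ} (hs : 0 < s) (hs1 : s ≤ 1) (k : ℕ)
    (hA : ∀ j, -1 < A j) (hB : ∀ j, -1 < B j) (hsAB : s ≤ A j + B j + 2)
    (g : ℕ → (Fin h → ℝ) → ℝ) (hg : ∀ r < k, IsWeakPartial j (g r) (g (r + 1)))
    (hi : ∀ r ≤ k, Integrable (g r) (jacobiMeasure A B)) (n : Fin h → ℕ) :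
    coeffSq A B (g 0) (n + Pi.single j k) ≤
      coeffSq (A + Pi.single j (k : ℝ)) (B + Pi.single j (k : ℝ)) (g k) n /
        (s * (n j + 1) ^ 2) ^ k := by
  induction k generalizing A B g with
  | zero => simp
  | succ k ih =>
    have hle := jacobiMeasure_add_single_le (A := A) (B := B) j 1
    rw [Nat.cast_one] at hle
    have e1 : (n + Pi.single j (k + 1) : Fin h → ℕ) = n + Pi.single j k + Pi.single j 1 := by
      rw [Pi.single_add, add_assoc]
    have e2 (D : Fin h → ℝ) : D + Pi.single j ((k + 1 : ℕ) : ℝ) =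
        D + Pi.single j 1 + Pi.single j (k : ℝ) := by
      rw [Nat.cast_succ, add_comm (k : ℝ), Pi.single_add, add_assoc]
    rw [e1, coeffSq_add_single hA hB j (hg 0 (by omega)) (hi 0 (by omega)) (hi (0 + 1) (by omega)),
      e2, e2, pow_succ, ← div_div (coeffSq _ _ (g (k + 1)) n)]
    have ih' := ih (neg_one_lt_add_single hA j zero_le_one) (neg_one_lt_add_single hB j zero_le_one)
      (by simp only [Pi.add_apply, Pi.single_eq_same]; linarith) (fun r => g (r + 1))
      (fun r hr => hg (r + 1) (by omega)) (fun r hr => (hi (r + 1) (by omega)).mono_measure hle)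
    have hc := coeffSq_nonneg (neg_one_lt_add_single hA j zero_le_one)
      (neg_one_lt_add_single hB j zero_le_one) (g (0 + 1)) (n + Pi.single j k)
    refine div_le_div₀ (hc.trans ih') ih' (by positivity) ?_
    have hk : (0 : ℝ) ≤ k := k.cast_nonneg
    have hn : (0 : ℝ) ≤ n j := (n j).cast_nonneg
    simp only [Pi.add_apply, Pi.single_eq_same, Nat.cast_add]
    -- Both `s ≤ 1` and `s ≤ A j + B j + 2` enter: `s` guards against exponents near `-1`, for which
    -- `A j + B j + 2` is small.
    have h1 : s * (n j + 1) ≤ n j + k + A j + B j + 2 := by nlinarith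
    have h2 : (n j + 1 : ℝ) ≤ n j + k + 1 := by linarith
    calc s * (n j + 1 : ℝ) ^ 2 = (n j + 1) * (s * (n j + 1)) := by ring
      _ ≤ _ := mul_le_mul h2 h1 (by positivity) (by positivity)

theorem integral_sq_mono_measure {μ ν : Measure (Fin h → ℝ)} (hμν : μ ≤ ν) {u : (Fin h → ℝ) → ℝ}
    (hu : MemLp u 2 ν) : ∫ x, u x ^ 2 ∂μ ≤ ∫ x, u x ^ 2 ∂ν :=
  integral_mono_measure hμν (.of_forall fun _ => sq_nonneg _) hu.integrable_sq

theorem sub_single_add_single {j : Fin h} {k : ℕ} {n : Fin h → ℕ} (hn : k ≤ n j) :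
    n - Pi.single j k + Pi.single j k = n := by
  ext i
  by_cases hij : i = j
  · subst hij; simp [hn]
  · simp [hij]

theorem coeffSq_le_of_lt {j : Fin h} {s : ℝ} (hs : 0 < s) (hs1 : s ≤ 1) {k N : ℕ}
    (hN : 2 * h * k ≤ N) (hN0 : 0 < N) (hA : ∀ j, -1 < A j) (hB : ∀ j, -1 < B j)
    (hsAB : s ≤ A j + B j + 2) (g : ℕ → (Fin h → ℝ) → ℝ)
    (hg : ∀ r < k, IsWeakPartial j (g r) (g (r + 1)))
    (hi : ∀ r ≤ k, Integrable (g r) (jacobiMeasure A B)) {n : Fin h → ℕ} (hk : k ≤ n j)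
    (hn : N < h * n j) :
    coeffSq A B (g 0) n ≤ ((2 * h) ^ 2 / s) ^ k * ((N : ℝ) ^ k)⁻¹ ^ 2 *
      coeffSq (A + Pi.single j (k : ℝ)) (B + Pi.single j (k : ℝ)) (g k) (n - Pi.single j k) := by
  have hk0 : (0 : ℝ) ≤ k := k.cast_nonneg
  have hNpos : (0 : ℝ) < N := by exact_mod_cast hN0
  have hh : (0 : ℝ) < h := by exact_mod_cast j.pos
  obtain ⟨m, rfl⟩ : ∃ m : Fin h → ℕ, n = m + Pi.single j k := ⟨_, (sub_single_add_single hk).symm⟩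
  rw [add_tsub_cancel_right]
  refine (coeffSq_add_single_le hs hs1 k hA hB hsAB g hg hi m).trans ?_
  rw [div_eq_inv_mul]
  refine mul_le_mul_of_nonneg_right ?_
    (coeffSq_nonneg (neg_one_lt_add_single hA j hk0) (neg_one_lt_add_single hB j hk0) _ _)
  -- With `n_j = m_j + k`, `N < h * n_j` and `h * k ≤ N / 2` give `h * m_j > N / 2`: the shift by
  -- `k` costs at most half of the frequency.
  have h2 : (N : ℝ) / (2 * h) ≤ (m j : ℝ) + 1 := by
    rw [div_le_iff₀ (by positivity)]
    rw [Pi.add_apply, Pi.single_eq_same] at hn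
    have : N ≤ (m j + 1) * (2 * h) := by nlinarith
    exact_mod_cast this
  have h4 : ((2 * h) ^ 2 / s) ^ k * ((N : ℝ) ^ k)⁻¹ ^ 2 = ((s * ((N : ℝ) / (2 * h)) ^ 2) ^ k)⁻¹ := by
    rw [← inv_pow, ← pow_mul, mul_comm k 2, pow_mul, ← mul_pow, ← inv_pow]
    congr 1
    field_simp
  rw [h4]
  gcongr

/-- Decay of the high-degree Fourier coefficients in one direction. -/
theorem sum_coeffSq_le_of_weakPartial {j : Fin h} {s : ℝ} (hs : 0 < s) (hs1 : s ≤ 1) {k N : ℕ}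
    (hN : 2 * h * k ≤ N) (hN0 : 0 < N) (hA : ∀ j, -1 < A j) (hB : ∀ j, -1 < B j)
    (hsAB : s ≤ A j + B j + 2) (g : ℕ → (Fin h → ℝ) → ℝ)
    (hg : ∀ r < k, IsWeakPartial j (g r) (g (r + 1)))
    (hi : ∀ r ≤ k, MemLp (g r) 2 (jacobiMeasure A B)) (T : Finset (Fin h → ℕ))
    (hT : ∀ n ∈ T, N < h * n j) :
    ∑ n ∈ T, coeffSq A B (g 0) n ≤
      ((2 * h) ^ 2 / s) ^ k * ((N : ℝ) ^ k)⁻¹ ^ 2 * ∫ x, g k x ^ 2 ∂jacobiMeasure A B := by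
  classical
  have := isFiniteMeasure_jacobiMeasure hA hB
  have hk0 : (0 : ℝ) ≤ k := k.cast_nonneg
  have hle : ∀ n ∈ T, k ≤ n j := fun n hn => by
    have h1 := hT n hn
    by_contra! hc
    nlinarith [Nat.mul_le_mul_left h hc.le]
  have hterm : ∀ n ∈ T, _ := fun n hn => coeffSq_le_of_lt hs hs1 hN hN0 hA hB hsAB g hg
    (fun r hr => (hi r hr).integrable (by norm_num)) (hle n hn) (hT n hn)
  have hmono := jacobiMeasure_add_single_le (A := A) (B := B) j k
  refine (Finset.sum_le_sum hterm).trans ?_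
  rw [← Finset.mul_sum]
  refine mul_le_mul_of_nonneg_left ?_ (by positivity)
  -- Bessel's inequality is used in the raised measure and the result compared with the original
  -- one. The shifted indices stay distinct because `k ≤ n_j` on `T`.
  refine le_trans ?_ (integral_sq_mono_measure hmono (hi k le_rfl))
  refine le_trans (le_of_eq ?_) (sum_coeffSq_le (neg_one_lt_add_single hA j hk0)
    (neg_one_lt_add_single hB j hk0) ((hi k le_rfl).mono_measure hmono)
    (T.image fun n => n - Pi.single j k))
  refine (Finset.sum_image fun n hn m hm hnm => ?_).symm
  rw [← sub_single_add_single (hle n hn), ← sub_single_add_single (hle m hm)]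
  exact congrArg (· + Pi.single j k) hnm

/-- Jackson-type estimate: polynomial approximation of total degree `N` in the weighted `L²` space,
controlled by the pure weak derivatives of order `k`. -/
theorem exists_mvPolynomial_approx (hh : 0 < h) (hA : ∀ j, -1 < A j) (hB : ∀ j, -1 < B j)
    (k : ℕ) :
    ∃ C : ℝ, 0 ≤ C ∧ ∀ N : ℕ, 0 < N → ∀ g : Fin h → ℕ → (Fin h → ℝ) → ℝ,
      ∀ u : (Fin h → ℝ) → ℝ, (∀ j, g j 0 = u) →
      (∀ j, ∀ r < k, IsWeakPartial j (g j r) (g j (r + 1))) →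
      (∀ j, ∀ r ≤ k, MemLp (g j r) 2 (jacobiMeasure A B)) →
      ∃ p : MvPolynomial (Fin h) ℝ, p.totalDegree ≤ N ∧
        ∫ x, (u x - MvPolynomial.eval x p) ^ 2 ∂jacobiMeasure A B ≤
          C * ((N : ℝ) ^ k)⁻¹ ^ 2 * (∫ x, u x ^ 2 ∂jacobiMeasure A B +
            ∑ j, ∫ x, g j k x ^ 2 ∂jacobiMeasure A B) := by
  classical
  have : Nonempty (Fin h) := ⟨⟨0, hh⟩⟩
  obtain ⟨i, hi⟩ := Finite.exists_min fun j => A j + B j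
  set s := min 1 (A i + B i + 2) with hs_def
  have hs : 0 < s := lt_min one_pos (by linarith [hA i, hB i])
  have hsAB (j) : s ≤ A j + B j + 2 := (min_le_right _ _).trans (by linarith [hi j])
  set C₁ : ℝ := ((2 * h) ^ 2 / s) ^ k
  -- `C₂` serves the small orders `N < 2 * h * k`, where `C₂ * N ^ (-2k) ≥ 1` and the zero
  -- polynomial suffices; `C₁` is the constant of the tail estimate.
  set C₂ : ℝ := ((2 * h * k) ^ k) ^ 2
  have hC₁ : 0 ≤ C₁ := by positivity
  have hC₂ : 0 ≤ C₂ := by positivity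
  refine ⟨C₁ + C₂, by positivity, fun N hN g u hu hg hm => ?_⟩
  have hN' : (0 : ℝ) < N := by exact_mod_cast hN
  set J := jacobiMeasure A B
  set I := ∫ x, u x ^ 2 ∂J
  set G := ∑ j, ∫ x, g j k x ^ 2 ∂J
  have hI : 0 ≤ I := integral_nonneg fun _ => sq_nonneg _
  have hG : 0 ≤ G := Finset.sum_nonneg fun _ _ => integral_nonneg fun _ => sq_nonneg _
  set E := ((N : ℝ) ^ k)⁻¹ ^ 2 with hE
  have hE0 : 0 ≤ E := by positivity
  rcases lt_or_ge N (2 * h * k) with hsmall | hlarge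
  · refine ⟨0, by simp, ?_⟩
    have h1 : 1 ≤ C₂ * E := by
      rw [hE, inv_pow, ← div_eq_mul_inv, one_le_div (by positivity)]
      have : (N : ℝ) ≤ 2 * h * k := by exact_mod_cast hsmall.le
      exact pow_le_pow_left₀ (by positivity) (pow_le_pow_left₀ (by positivity) this k) 2
    simp only [map_zero, sub_zero]
    calc I ≤ C₂ * E * I := le_mul_of_one_le_left hI h1
      _ ≤ (C₁ + C₂) * E * (I + G) :=
          mul_le_mul (mul_le_mul_of_nonneg_right (by linarith) hE0) (by linarith) hI (by positivity)
  · have hu2 : MemLp u 2 J := by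
      rw [← hu i]
      exact hm i 0 (Nat.zero_le _)
    obtain ⟨c, hc⟩ := exists_truncation hA hB hu2
      (Fintype.piFinset fun _ => Finset.range (N / h + 1)) (R := C₁ * E * G) (fun T hT => by
        have hex : ∀ n ∈ T, ∃ j, N < h * n j := by
          intro n hn
          by_contra! hcon
          refine Finset.disjoint_left.1 hT hn (Fintype.mem_piFinset.2 fun j => ?_)
          rw [Finset.mem_range, Nat.lt_succ_iff, Nat.le_div_iff_mul_le hh, mul_comm]
          exact hcon j
        -- Every index outside the box is large in at least one direction; counting it once for each
        -- such direction only increases the sum.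
        calc ∑ n ∈ T, coeffSq A B u n
            ≤ ∑ n ∈ T, ∑ j, if N < h * n j then coeffSq A B u n else 0 := by
              refine Finset.sum_le_sum fun n hn => ?_
              obtain ⟨j, hj⟩ := hex n hn
              refine le_trans (by simp [hj]) (Finset.single_le_sum (f := fun j =>
                if N < h * n j then coeffSq A B u n else 0) (fun j _ => ?_) (Finset.mem_univ j))
              split_ifs
              exacts [coeffSq_nonneg hA hB _ _, le_rfl]
          _ = ∑ j, ∑ n ∈ T.filter fun n => N < h * n j, coeffSq A B u n := by
              rw [Finset.sum_comm]
              simp_rw [Finset.sum_filter]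
          _ ≤ ∑ j, C₁ * E * ∫ x, g j k x ^ 2 ∂J := by
              refine Finset.sum_le_sum fun j _ => ?_
              rw [← hu j]
              exact sum_coeffSq_le_of_weakPartial hs (min_le_left _ _) hlarge hN hA hB (hsAB j)
                (g j) (hg j) (hm j) _ fun n hn => (Finset.mem_filter.1 hn).2
          _ = C₁ * E * G := (Finset.mul_sum _ _ _).symm)
    refine ⟨_, ?_, hc.trans ?_⟩
    · refine MvPolynomial.totalDegree_finsetSum_le fun n hn => ?_
      refine (MvPolynomial.totalDegree_smul_le _ _).trans
        ((totalDegree_tensorJacobi_le n).trans ?_)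
      calc ∑ j, n j ≤ ∑ _j : Fin h, N / h := Finset.sum_le_sum fun j _ =>
            Nat.lt_succ_iff.1 (Finset.mem_range.1 (Fintype.mem_piFinset.1 hn j))
        _ ≤ N := by simpa using Nat.mul_div_le N h
    · exact mul_le_mul (mul_le_mul_of_nonneg_right (by linarith) hE0) (by linarith) hG
        (by positivity)

end Approximation
end TensorLSTM

namespace TensorLSTM

/-! ### Components of vector-valued weak derivatives -/

section Components

variable {h : ℕ}

theorem multiDeriv_single (j : Fin h) (r : ℕ) (φ : (Fin h → ℝ) → ℝ) :
    multiDeriv (Pi.single j r) φ = (partialDeriv j)^[r] φ := by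
  have key : ∀ l : List (Fin h), l.Nodup →
      l.foldr (fun i ψ => (partialDeriv i)^[(Pi.single j r : Fin h → ℕ) i] ψ) φ =
        if j ∈ l then (partialDeriv j)^[r] φ else φ := by
    intro l hl
    induction l with
    | nil => simp
    | cons i l ih =>
      obtain ⟨hi, hl⟩ := List.nodup_cons.1 hl
      rw [List.foldr_cons, ih hl]
      by_cases hij : i = j
      · subst hij; simp [hi]
      · simp [hij, Ne.symm hij]
  exact (key _ (List.nodup_finRange h)).trans (if_pos (List.mem_finRange j))

theorem multiDeriv_zero (φ : (Fin h → ℝ) → ℝ) : multiDeriv 0 φ = φ := by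
  have : ∀ l : List (Fin h),
      l.foldr (fun i ψ => (partialDeriv i)^[(0 : Fin h → ℕ) i] ψ) φ = φ := by
    intro l
    induction l with
    | nil => rfl
    | cons i l ih => rw [List.foldr_cons, ih]; rfl
  exact this _

/-- Test functions on the open cube. -/
structure IsTestFunction (φ : (Fin h → ℝ) → ℝ) : Prop where
  contDiff : ContDiff ℝ ((⊤ : ℕ∞) : WithTop ℕ∞) φ
  hasCompactSupport : HasCompactSupport φ
  tsupport_subset : tsupport φ ⊆ cube h

theorem IsTestFunction.partialDeriv {φ : (Fin h → ℝ) → ℝ} (hφ : IsTestFunction φ) (j : Fin h) :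
    IsTestFunction (partialDeriv j φ) where
  contDiff := (hφ.contDiff.fderiv_right (m := ((⊤ : ℕ∞) : WithTop ℕ∞)) (by simp)).clm_apply
    contDiff_const
  hasCompactSupport := hφ.hasCompactSupport.fderiv_apply (𝕜 := ℝ) _
  tsupport_subset := (tsupport_fderiv_apply_subset ℝ _).trans hφ.tsupport_subset

theorem IsTestFunction.iterate_partialDeriv {φ : (Fin h → ℝ) → ℝ} (hφ : IsTestFunction φ)
    (j : Fin h) (r : ℕ) : IsTestFunction ((TensorLSTM.partialDeriv j)^[r] φ) := by
  induction r generalizing φ with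
  | zero => exact hφ
  | succ r ih => exact ih (hφ.partialDeriv j)

theorem IsTestFunction.integrableOn_smul {E : Type*} [NormedAddCommGroup E] [NormedSpace ℝ E]
    {φ : (Fin h → ℝ) → ℝ} (hφ : IsTestFunction φ) {f : (Fin h → ℝ) → E}
    (hf : LocallyIntegrableOn f (cube h)) : IntegrableOn (fun x => φ x • f x) (cube h) := by
  have h1 : IntegrableOn f (tsupport φ) :=
    hf.integrableOn_compact_subset hφ.tsupport_subset hφ.hasCompactSupport
  have h2 : IntegrableOn (fun x => φ x • f x) (tsupport φ) :=
    h1.continuousOn_smul hφ.contDiff.continuous.continuousOn hφ.hasCompactSupport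
  refine (h2.integrable_of_forall_notMem_eq_zero fun x hx => ?_).integrableOn
  rw [image_eq_zero_of_notMem_tsupport hx, zero_smul]

theorem isWeakDeriv_weakDeriv {E : Type*} [NormedAddCommGroup E] [NormedSpace ℝ E] {i : Fin h → ℕ}
    {f : (Fin h → ℝ) → E} (H : ∃ g, IsWeakDeriv i f g) : IsWeakDeriv i f (weakDeriv i f) := by
  rw [weakDeriv, dif_pos H]
  exact H.choose_spec

/-- Fundamental lemma of the calculus of variations. It is needed because `weakDeriv 0 f` is an
arbitrary choice and need not be `f` itself. -/
theorem IsWeakDeriv.ae_eq {E : Type*} [NormedAddCommGroup E] [NormedSpace ℝ E] [CompleteSpace E]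
    {f g : (Fin h → ℝ) → E} (H : IsWeakDeriv 0 f g) : f =ᵐ[volume.restrict (cube h)] g := by
  obtain ⟨hf, hg, H⟩ := H
  rw [Filter.EventuallyEq, ae_restrict_iff' measurableSet_cube]
  have := isOpen_cube.ae_eq_zero_of_integral_contDiff_smul_eq_zero (f := fun x => f x - g x)
    (μ := volume) (hf.sub hg) fun φ h1 h2 h3 => ?_
  · filter_upwards [this] with x hx hxc using sub_eq_zero.1 (hx hxc)
  · have hφ : IsTestFunction φ := ⟨h1, h2, h3⟩
    have hH := H φ h1 h2 h3
    rw [multiDeriv_zero] at hH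
    rw [← setIntegral_eq_integral_of_forall_compl_eq_zero (s := cube h) fun x hx => by
      rw [image_eq_zero_of_notMem_tsupport fun hx' => hx (h3 hx'), zero_smul]]
    simp_rw [smul_sub]
    rw [integral_sub (hφ.integrableOn_smul hf) (hφ.integrableOn_smul hg), hH]
    simp

theorem IsWeakDeriv.integral_component {m : ℕ} {j : Fin h} {r : ℕ}
    {f g : (Fin h → ℝ) → EuclideanSpace ℝ (Fin m)} (H : IsWeakDeriv (Pi.single j r) f g)
    (c : Fin m) {φ : (Fin h → ℝ) → ℝ} (hφ : IsTestFunction φ) :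
    ∫ x in cube h, (partialDeriv j)^[r] φ x * f x c =
      (-1) ^ r * ∫ x in cube h, φ x * g x c := by
  obtain ⟨hf, hg, H⟩ := H
  have h1 := congrArg (EuclideanSpace.proj (𝕜 := ℝ) c)
    (H φ hφ.contDiff hφ.hasCompactSupport hφ.tsupport_subset)
  rw [multiDeriv_single, map_smul,
    ← ContinuousLinearMap.integral_comp_comm _ ((hφ.iterate_partialDeriv j r).integrableOn_smul hf),
    ← ContinuousLinearMap.integral_comp_comm _ (hφ.integrableOn_smul hg)] at h1
  simpa using h1

/-- The derivative of order `r` tested against `∂_j φ` and that of order `r + 1` tested against `φ`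
have the same left side; cancelling `(-1) ^ r` leaves the first-order relation. -/
theorem isWeakPartial_weakDeriv {m : ℕ} {j : Fin h} {r : ℕ}
    {f : (Fin h → ℝ) → EuclideanSpace ℝ (Fin m)} (h1 : ∃ g, IsWeakDeriv (Pi.single j r) f g)
    (h2 : ∃ g, IsWeakDeriv (Pi.single j (r + 1)) f g) (c : Fin m) :
    IsWeakPartial j (fun x => weakDeriv (Pi.single j r) f x c)
      (fun x => weakDeriv (Pi.single j (r + 1)) f x c) := by
  intro φ hd hc hs
  have hφ : IsTestFunction φ := ⟨hd, hc, hs⟩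
  have e1 := (isWeakDeriv_weakDeriv h1).integral_component c (hφ.partialDeriv j)
  have e2 := (isWeakDeriv_weakDeriv h2).integral_component c hφ
  rw [Function.iterate_succ_apply, e1, pow_succ, mul_assoc] at e2
  simpa using mul_left_cancel₀ (pow_ne_zero r (by norm_num)) e2

end Components

/-! ### Vector-valued approximation -/

section VectorValued

open scoped ENNReal

variable {h m : ℕ}

theorem eLpNorm_two_sq {μ : Measure (Fin h → ℝ)} {f : (Fin h → ℝ) → EuclideanSpace ℝ (Fin m)}
    (hf : MemLp f 2 μ) :
    eLpNorm f 2 μ ^ 2 = ENNReal.ofReal (∑ c, ∫ x, f x c ^ 2 ∂μ) := by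
  have hc (c) : Integrable (fun x => f x c ^ 2) μ :=
    ((EuclideanSpace.proj (𝕜 := ℝ) c).comp_memLp' hf).integrable_sq
  rw [← integral_finsetSum _ fun c _ => hc c]
  simp_rw [← EuclideanSpace.real_norm_sq_eq]
  rw [hf.eLpNorm_eq_integral_rpow_norm (by norm_num) (by norm_num),
    ← ENNReal.ofReal_pow (by positivity)]
  congr 1
  have h0 : 0 ≤ ∫ x, ‖f x‖ ^ 2 ∂μ := integral_nonneg fun _ => sq_nonneg _
  rw [← Real.rpow_natCast, ← Real.rpow_mul (by positivity)]
  simp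

theorem eLpNorm_weakDeriv_le_sobolevNorm {E : Type*} [NormedAddCommGroup E] [NormedSpace ℝ E]
    {k : ℕ} {μ : Measure (Fin h → ℝ)} {f : (Fin h → ℝ) → E} {i : Fin h → ℕ} (hi : ∑ j, i j ≤ k) :
    eLpNorm (weakDeriv i f) 2 μ ≤ sobolevNorm k μ f := by
  have h1 : eLpNorm (weakDeriv i f) 2 μ ≤
      ∑ i ∈ Finset.piAntidiag (Finset.univ : Finset (Fin h)) (∑ j, i j),
        eLpNorm (weakDeriv i f) 2 μ :=
    Finset.single_le_sum (f := fun i => eLpNorm (weakDeriv i f) 2 μ) (fun _ _ => zero_le)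
      (by simp)
  refine h1.trans ?_
  exact Finset.single_le_sum (f := fun n =>
    ∑ i ∈ Finset.piAntidiag (Finset.univ : Finset (Fin h)) n, eLpNorm (weakDeriv i f) 2 μ)
    (fun _ _ => zero_le) (Finset.mem_range.2 (Nat.lt_succ_of_le hi))

theorem weakDeriv_zero_ae_eq {E : Type*} [NormedAddCommGroup E] [NormedSpace ℝ E] [CompleteSpace E]
    {k : ℕ} {μ : Measure (Fin h → ℝ)} (hμ : μ ≪ volume.restrict (cube h)) {f : (Fin h → ℝ) → E}
    (hf : MemSobolev k μ f) : f =ᵐ[μ] weakDeriv 0 f :=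
  hμ.ae_eq (isWeakDeriv_weakDeriv (hf.2 0 (by simp)).1).ae_eq

theorem eLpNorm_le_sobolevNorm {E : Type*} [NormedAddCommGroup E] [NormedSpace ℝ E]
    [CompleteSpace E] {k : ℕ} {μ : Measure (Fin h → ℝ)} (hμ : μ ≪ volume.restrict (cube h))
    {f : (Fin h → ℝ) → E} (hf : MemSobolev k μ f) : eLpNorm f 2 μ ≤ sobolevNorm k μ f := by
  rw [eLpNorm_congr_ae (weakDeriv_zero_ae_eq hμ hf)]
  exact eLpNorm_weakDeriv_le_sobolevNorm (by simp)

theorem eLpNorm_two_le_of_le_smul {E : Type*} [NormedAddCommGroup E] {μ ν : Measure (Fin h → ℝ)}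
    {c : NNReal} (hle : μ ≤ c • ν) (f : (Fin h → ℝ) → E) :
    eLpNorm f 2 μ ≤ (c ^ (1 / 2 : ℝ) : NNReal) * eLpNorm f 2 ν := by
  refine (eLpNorm_mono_measure f hle).trans ?_
  refine (eLpNorm_smul_measure_le (c : ℝ≥0∞) f 2 ν).trans (le_of_eq ?_)
  rw [smul_eq_mul, ENNReal.coe_rpow_of_nonneg _ (by norm_num)]
  norm_num

theorem MemSobolev.of_le_smul {E : Type*} [NormedAddCommGroup E] [NormedSpace ℝ E]
    {k : ℕ} {μ ν : Measure (Fin h → ℝ)} {c : NNReal} (hle : μ ≤ c • ν) {f : (Fin h → ℝ) → E}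
    (hf : MemSobolev k ν f) : MemSobolev k μ f := by
  have key {g : (Fin h → ℝ) → E} (hg : MemLp g 2 ν) : MemLp g 2 μ :=
    MemLp.mono_measure hle (hg.smul_measure (c := (c : ℝ≥0∞)) ENNReal.coe_ne_top)
  exact ⟨key hf.1, fun i hi => ⟨(hf.2 i hi).1, key (hf.2 i hi).2⟩⟩

theorem sobolevNorm_le_of_le_smul {E : Type*} [NormedAddCommGroup E] [NormedSpace ℝ E]
    {k : ℕ} {μ ν : Measure (Fin h → ℝ)} {c : NNReal} (hle : μ ≤ c • ν) (f : (Fin h → ℝ) → E) :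
    sobolevNorm k μ f ≤ (c ^ (1 / 2 : ℝ) : NNReal) * sobolevNorm k ν f := by
  simp only [sobolevNorm, Finset.mul_sum]
  exact Finset.sum_le_sum fun _ _ => Finset.sum_le_sum fun _ _ => eLpNorm_two_le_of_le_smul hle _

theorem exists_mvPolynomial_approx_vector {A B : Fin h → ℝ} (hh : 0 < h) (hA : ∀ j, -1 < A j)
    (hB : ∀ j, -1 < B j) (k : ℕ) :
    ∃ C : NNReal, ∀ N : ℕ, 0 < N → ∀ (m : ℕ) (f : (Fin h → ℝ) → EuclideanSpace ℝ (Fin m)),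
      MemSobolev k (jacobiMeasure A B) f →
      ∃ p : Fin m → MvPolynomial (Fin h) ℝ, (∀ c, (p c).totalDegree ≤ N) ∧
        eLpNorm (fun x => f x - WithLp.toLp 2 fun c => MvPolynomial.eval x (p c)) 2
            (jacobiMeasure A B) ≤
          C * ((N : ℝ≥0∞) ^ k)⁻¹ * sobolevNorm k (jacobiMeasure A B) f := by
  obtain ⟨C, hC, H⟩ := exists_mvPolynomial_approx hh hA hB k
  set J := jacobiMeasure A B
  -- The count `h + 1` stands for `f` and its `h` pure derivatives of order `k`, each bounded by the
  -- full Sobolev norm.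
  refine ⟨(√(C * (h + 1))).toNNReal, fun N hN m f hf => ?_⟩
  have hsum (j : Fin h) (r : ℕ) : ∑ i, (Pi.single j r : Fin h → ℕ) i = r := by simp
  have hmem (j : Fin h) (r : ℕ) (hr : r ≤ k) := hf.2 (Pi.single j r) (by rwa [hsum])
  choose p hpdeg hp using fun c : Fin m => H N hN
    (fun j r x => weakDeriv (Pi.single j r) f x c) (fun x => weakDeriv 0 f x c)
    (fun j => by simp) (fun j r hr => isWeakPartial_weakDeriv (hmem j r hr.le).1
      (hmem j (r + 1) hr).1 c)
    (fun j r hr => (EuclideanSpace.proj (𝕜 := ℝ) c).comp_memLp' (hmem j r hr).2)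
  refine ⟨p, hpdeg, ?_⟩
  have hcont : Continuous fun x : Fin h → ℝ =>
      (WithLp.toLp 2 fun c => MvPolynomial.eval x (p c) : EuclideanSpace ℝ (Fin m)) :=
    (PiLp.continuous_toLp 2 _).comp (continuous_pi fun c => MvPolynomial.continuous_eval (p c))
  have h0 := (hf.2 0 (by simp)).2
  have hF := h0.sub (memLp_jacobiMeasure_of_continuous hA hB hcont)
  have hae := weakDeriv_zero_ae_eq jacobiMeasure_absolutelyContinuous hf
  rw [eLpNorm_congr_ae (g := weakDeriv 0 f - fun x => WithLp.toLp 2 fun c =>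
    MvPolynomial.eval x (p c)) (hae.mono fun x hx => by simp [hx])]
  refine (ENNReal.pow_le_pow_left_iff two_ne_zero).1 ?_
  rw [eLpNorm_two_sq hF]
  set K := C * ((N : ℝ) ^ k)⁻¹ ^ 2 with hK
  have hK0 : 0 ≤ K := by positivity
  have hN' : (0 : ℝ) < N := by exact_mod_cast hN
  calc _ ≤ ENNReal.ofReal (∑ c, K * (∫ x, weakDeriv 0 f x c ^ 2 ∂J +
          ∑ j, ∫ x, weakDeriv (Pi.single j k) f x c ^ 2 ∂J)) :=
        ENNReal.ofReal_le_ofReal (Finset.sum_le_sum fun c _ => by simpa using hp c)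
    _ = ENNReal.ofReal K * (eLpNorm (weakDeriv 0 f) 2 J ^ 2 +
          ∑ j, eLpNorm (weakDeriv (Pi.single j k) f) 2 J ^ 2) := by
        have hnn (g : (Fin h → ℝ) → EuclideanSpace ℝ (Fin m)) :
            0 ≤ ∑ c, ∫ x, g x c ^ 2 ∂J :=
          Finset.sum_nonneg fun _ _ => integral_nonneg fun _ => sq_nonneg _
        rw [eLpNorm_two_sq h0, Finset.sum_congr rfl fun j _ => eLpNorm_two_sq (hmem j k le_rfl).2,
          ← ENNReal.ofReal_sum_of_nonneg fun j _ => hnn _,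
          ← ENNReal.ofReal_add (hnn _) (Finset.sum_nonneg fun j _ => hnn _),
          ← ENNReal.ofReal_mul hK0, ← Finset.mul_sum, Finset.sum_add_distrib,
          Finset.sum_comm (s := Finset.univ (α := Fin m))]
    _ ≤ ENNReal.ofReal K * (sobolevNorm k J f ^ 2 + ∑ _j : Fin h, sobolevNorm k J f ^ 2) := by
        gcongr with j
        · exact eLpNorm_weakDeriv_le_sobolevNorm (by simp)
        · exact eLpNorm_weakDeriv_le_sobolevNorm (by rw [hsum])
    _ = (ENNReal.ofReal (√(C * (h + 1))) * ((N : ℝ≥0∞) ^ k)⁻¹ * sobolevNorm k J f) ^ 2 := by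
        have e1 : ((N : ℝ≥0∞) ^ k)⁻¹ = ENNReal.ofReal ((N : ℝ) ^ k)⁻¹ := by
          rw [ENNReal.ofReal_inv_of_pos (by positivity), ENNReal.ofReal_pow hN'.le,
            ENNReal.ofReal_natCast]
        have e2 : (1 + h : ℝ≥0∞) = ENNReal.ofReal (h + 1) := by
          rw [ENNReal.ofReal_add (by positivity) zero_le_one, ENNReal.ofReal_natCast,
            ENNReal.ofReal_one, add_comm]
        rw [e1, Finset.sum_const, Finset.card_univ, Fintype.card_fin, nsmul_eq_mul, ← one_add_mul,
          e2, ← mul_assoc, ← ENNReal.ofReal_mul hK0, mul_pow, mul_pow,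
          ← ENNReal.ofReal_pow (by positivity), ← ENNReal.ofReal_pow (by positivity),
          ← ENNReal.ofReal_mul (by positivity), Real.sq_sqrt (by positivity), hK]
        congr 2
        ring

theorem measurable_activation : Measurable (activation (h := h)) := by
  unfold activation
  refine measurable_pi_lambda _ fun j => ?_
  simp_rw [Real.tanh_eq_sinh_div_cosh]
  fun_prop

theorem continuous_propagation {L Q : ℕ} (W : Fin L → Matrix (Fin Q) (Fin h) ℝ)
    (WT : Matrix (Fin m) (Fin L → Fin (Q + 1)) ℝ) : Continuous (propagation W WT) := by
  refine (PiLp.continuous_toLp 2 _).comp ?_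
  refine Continuous.matrix_mulVec continuous_const (continuous_pi fun s => ?_)
  refine continuous_finsetProd _ fun l _ => ?_
  unfold localVec
  refine Fin.cases ?_ (fun q => ?_) (s l)
  · simpa using continuous_const
  · exact (continuous_apply q).comp
      (Continuous.matrix_mulVec (continuous_const (y := W l)) continuous_id)

end VectorValued

end TensorLSTM

namespace TensorLSTM

/-! ### Combining the read-out with the approximation estimate -/

open scoped ENNReal

theorem polyOrder_le (h L P : ℕ) : polyOrder h L P ≤ L := min_le_left _ _

theorem mul_polyOrder_le (h L P : ℕ) : h * polyOrder h L P ≤ L * (P - 1) :=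
  (Nat.mul_le_mul_left h (min_le_right _ _)).trans (Nat.mul_div_le _ _)

theorem exists_propagation_eq {h L Q N m : ℕ} (hNL : N ≤ L) (hNQ : h * N ≤ L * Q)
    (p : Fin m → MvPolynomial (Fin h) ℝ) (hp : ∀ c, (p c).totalDegree ≤ N) :
    ∃ WT : Matrix (Fin m) (Fin L → Fin (Q + 1)) ℝ, ∀ y,
      propagation (coordinateWeights h L Q N) WT y =
        WithLp.toLp 2 fun c => MvPolynomial.eval y (p c) := by
  choose w hw using fun c => exists_readout_of_totalDegree_le hNL hNQ (p c) (hp c)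
  exact ⟨Matrix.of w, fun y => congrArg (WithLp.toLp 2) (funext fun c => hw c y)⟩

/-- The approximation estimate for a measure of Jacobi type. -/
theorem exists_readout_approx (h k : ℕ) (hh : 0 < h) (μ : Measure (Fin h → ℝ))
    (hμ : IsJacobiType μ) :
    ∃ C : NNReal, ∀ L P m : ℕ, ∀ f : (Fin h → ℝ) → EuclideanSpace ℝ (Fin m),
      MemSobolev k μ f →
      ∃ WT : Matrix (Fin m) (Fin L → Fin (P - 1 + 1)) ℝ,
        eLpNorm (fun y => f y -
            propagation (coordinateWeights h L (P - 1) (polyOrder h L P)) WT y) 2 μ ≤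
          C * ((polyOrder h L P : ℝ≥0∞) ^ k)⁻¹ * sobolevNorm k μ f := by
  obtain ⟨A, B, hA, hB, a, b, ha, haμ, hμb⟩ := hμ
  have hJμ : jacobiMeasure A B ≤ a⁻¹ • μ := by
    refine Measure.le_iff'.2 fun t => ?_
    have h1 : (a : ℝ≥0∞) * jacobiMeasure A B t ≤ μ t := haμ t
    have h2 : (a⁻¹ • μ) t = (a : ℝ≥0∞)⁻¹ * μ t := by
      rw [← ENNReal.coe_inv ha.ne']
      rfl
    rw [h2]
    calc jacobiMeasure A B t = (a : ℝ≥0∞)⁻¹ * (a * jacobiMeasure A B t) := by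
          rw [← mul_assoc, ENNReal.inv_mul_cancel (by exact_mod_cast ha.ne') ENNReal.coe_ne_top,
            one_mul]
      _ ≤ _ := by gcongr
  have hac : μ ≪ volume.restrict (cube h) :=
    (Measure.absolutelyContinuous_of_le_smul (c := (b : ℝ≥0∞)) hμb).trans
      jacobiMeasure_absolutelyContinuous
  obtain ⟨C, hC⟩ := exists_mvPolynomial_approx_vector hh hA hB k
  set c₁ := b ^ (1 / 2 : ℝ)
  set c₂ := a⁻¹ ^ (1 / 2 : ℝ)
  -- The summand `1` covers `N = 0`, where the zero read-out works because `(0 ^ k)⁻¹ ≥ 1` in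
  -- `ℝ≥0∞`; `c₁` and `c₂` pay for passing from `μ` to the Jacobi measure and back.
  refine ⟨1 + c₁ * C * c₂, fun L P m f hf => ?_⟩
  set N := polyOrder h L P with hN
  rcases Nat.eq_zero_or_pos N with h0 | hpos
  · refine ⟨0, ?_⟩
    have hzero (y : Fin h → ℝ) : propagation (coordinateWeights h L (P - 1) N)
        (0 : Matrix (Fin m) (Fin L → Fin (P - 1 + 1)) ℝ) y = 0 := by
      simp [propagation]
    simp_rw [hzero, sub_zero]
    refine (eLpNorm_le_sobolevNorm hac hf).trans ?_
    have h1 : (1 : ℝ≥0∞) ≤ ((N : ℝ≥0∞) ^ k)⁻¹ := by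
      rw [ENNReal.one_le_inv, h0, Nat.cast_zero]
      exact pow_le_one₀ zero_le zero_le_one
    have h2 : (1 : ℝ≥0∞) ≤ (1 + c₁ * C * c₂ : NNReal) := by
      rw [← ENNReal.coe_one, ENNReal.coe_le_coe]
      exact le_self_add
    exact le_mul_of_one_le_left' (one_le_mul h2 h1)
  · obtain ⟨p, hdeg, hp⟩ := hC N hpos m f (hf.of_le_smul hJμ)
    obtain ⟨WT, hWT⟩ := exists_propagation_eq (polyOrder_le h L P) (mul_polyOrder_le h L P) p hdeg
    refine ⟨WT, ?_⟩
    rw [← hN] at hWT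
    simp_rw [hWT]
    calc _ ≤ (c₁ : ℝ≥0∞) * (C * ((N : ℝ≥0∞) ^ k)⁻¹ * (c₂ * sobolevNorm k μ f)) := by
          refine (eLpNorm_two_le_of_le_smul hμb _).trans ?_
          gcongr
          refine hp.trans ?_
          gcongr
          exact sobolevNorm_le_of_le_smul hJμ f
      _ = (c₁ * C * c₂ : NNReal) * ((N : ℝ≥0∞) ^ k)⁻¹ * sobolevNorm k μ f := by
          push_cast
          ring
      _ ≤ _ := by
          gcongr
          exact le_add_self

end TensorLSTM

theorem theorem1 (h k : ℕ) (hh : 1 ≤ h) (μ : MeasureTheory.Measure (Fin h → ℝ))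
    (hμ : TensorLSTM.IsJacobiType μ) :
    ∃ C : NNReal, ∀ L P : ℕ, 1 ≤ P →
      (h : ℝ) ^ (1 + TensorLSTM.polyOrder h L P) - 1 ≤ ((h : ℝ) - 1) * h * (P : ℝ) ^ L →
      ∃ W : Fin L → Matrix (Fin (P - 1)) (Fin h) ℝ,
        ∀ (m : ℕ) (f : (Fin h → ℝ) → EuclideanSpace ℝ (Fin m)),
          TensorLSTM.MemSobolev k μ f →
          ∃ WT : Matrix (Fin m) (Fin L → Fin (P - 1 + 1)) ℝ,
            MeasureTheory.eLpNorm (fun y => f y - TensorLSTM.propagation W WT y) 2 μ ≤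
                C * ((TensorLSTM.polyOrder h L P : ENNReal) ^ k)⁻¹ *
                  TensorLSTM.sobolevNorm k μ f ∧
            ∀ ν : MeasureTheory.Measure (Fin h → ℝ),
              ν.map TensorLSTM.activation = μ →
              MeasureTheory.eLpNorm
                  (fun c => f (TensorLSTM.activation c) -
                    TensorLSTM.propagation W WT (TensorLSTM.activation c)) 2 ν ≤
                C * ((TensorLSTM.polyOrder h L P : ENNReal) ^ k)⁻¹ *
                  TensorLSTM.sobolevNorm k μ f := by
  obtain ⟨C, hC⟩ := TensorLSTM.exists_readout_approx h k hh μ hμ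
  refine ⟨C, fun L P _ _ => ⟨TensorLSTM.coordinateWeights h L (P - 1)
    (TensorLSTM.polyOrder h L P), fun m f hf => ?_⟩⟩
  obtain ⟨WT, hWT⟩ := hC L P m f hf
  refine ⟨WT, hWT, fun ν hν => ?_⟩
  subst hν
  -- The `ν`-norm of the composition is the norm under the image measure, so the bound carries over
  -- unchanged.
  exact (eLpNorm_map_measure (hf.1.aestronglyMeasurable.sub
    (TensorLSTM.continuous_propagation _ WT).aestronglyMeasurable)
    TensorLSTM.measurable_activation.aemeasurable).symm.trans_le hWT
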